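/- Let $\mathcal X$ be a semi-abelian category, $Z$ an object of $\mathcal X$ and $(A,\xi)$ a $Z$-module, that is, an internal abelian group $f\colon (A,\xi)\rtimes Z\to Z$ in the slice category $\mathcal X/Z$, where $A$ is the kernel of $f$ in $\mathcal X$. Let $n\ge 1$. Write $\Delta(\mathbb X,0)=\mathbb X_{-1}$ and, for $k\ge 1$, let $\Delta(\mathbb X,k)$ be the object of $k$-cycles of an augmented simplicial object $\mathbb X$, i.e. the simplicial kernel of the faces $\partial_0,\dots,\partial_{k-1}\colon\mathbb X_{k-1}\to\mathbb X_{k-2}$; for $k\ge 1$ and $0\le i\le k$ let $\Lambda^i(\mathbb X,k)$ be the object of $(k,i)$-horns (the universal object of tuples $(x_j)_{0\le j\le k,\,j\neq i}$ in $\mathbb X_{k-1}$ with $\partial_j x_l=\partial_{l-1}x_j$ for $j<l$, $j,l\ne i$; so $\Lambda^i(\mathbb X,1)=\mathbb X_0$). The augmented simplicial object $\mathbb K((A,\xi),n)$ in $\mathcal X/Z$ is the coskeleton of its $(n+1)$-truncation, which is terminal in degrees $<n$, is the abelian group $B=((A,\xi)\rtimes Z\to Z)$ in degree $n$, and is $B^{n+1}$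 in degree $n+1$, with $\partial_i=\mathrm{pr}_i$ for $0\le i\le n$ and $\partial_{n+1}=(-1)^n\sum_{i=0}^n(-1)^i\mathrm{pr}_i$. An $n$-torsor of $Z$ by $(A,\xi)$ is an augmented simplicial object $\mathbb T$ in $\mathcal X/Z$ with $\mathbb T_{-1}=Z$ (the terminal object of $\mathcal X/Z$), together with a simplicial morphism $t\colon\mathbb T\to\mathbb K((A,\xi),n)$, such that: (T1) $t$ is a fibration which is exact from degree $n$ on, that is, for all $k\ge 1$ and $0\le i\le k$ the comparison $\mathbb T_k\to\Lambda^i(\mathbb T,k)\times_{\Lambda^i(\mathbb K,k)}\mathbb K_k$ (with $\mathbb K=\mathbb K((A,\xi),n)$) is a regular epimorphism, and it is an isomorphism if $k\ge n$; (T2) $\mathbb T$ is canonically isomorphic to the coskeleton of its $(n-1)$-truncation; (T3) $\mathbb T$ is a resolution, that is, $(\partial_i)_i\colon\mathbb T_k\to\Delta(\mathbb T,k)$ is a regular epimorphism for all $k\ge 0$. Let $(\mathbb T,t)$ be such an $n$-torsor. Then the kernel in $\mathcal X$ of $$l_T=(\partial_i)_i\colon \mathbb T_{n-1}\to\Delta(\mathbb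 T,n-1)$$ is (isomorphic to) $A$, and the following conditions are equivalent: (i) the action $\xi$ is trivial, that is, $(A,\xi)\rtimes Z$ is $A\times Z$ with $f$ the product projection, with unit $(0,1_Z)$ and with kernel inclusion $(1_A,0)$; (ii) the regular epimorphism $l_T$ is a central extension with respect to abelianisation: its pullback along some regular epimorphism is a trivial extension, i.e. a regular epimorphism whose naturality square for the reflection of $\mathcal X$ onto its subcategory of abelian objects is a pullback; (iii) for every $i\in\{0,\dots,n-1\}$ the morphism $\Delta(\mathbb T,n)\to\Lambda^i(\mathbb T,n)$ which forgets the $i$-th entry is a product projection with kernel $A$, that is, $\Delta(\mathbb T,n)\cong A\times\Lambda^i(\mathbb T,n)$ over $\Lambda^i(\mathbb T,n)$. -/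

import Mathlib

open CategoryTheory CategoryTheory.Limits Opposite

universe v u

noncomputable section

namespace HigherTorsor

/-! ### Semi-abelian categories -/

/-- A semi-abelian category: pointed, Barr-exact (regular, and every internal equivalence relation
is a kernel pair), Bourn-protomodular (the Split Short Five Lemma holds), with binary coproducts. -/
class SemiAbelian (C : Type u) [Category.{v} C] [HasZeroMorphisms C] : Prop
    extends Regular C, HasZeroObject C, HasBinaryCoproducts C where
  exists_isKernelPair {R X : C} (p q : R ⟶ X) :
    IsEquivalenceRelation p q → ∃ (Y : C) (f : X ⟶ Y), IsKernelPair f p q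
  split_short_five {X' Y' X Y : C} (f' : X' ⟶ Y') (s' : Y' ⟶ X') (f : X ⟶ Y) (s : Y ⟶ X)
    (x : X' ⟶ X) (y : Y' ⟶ Y) (_ : s' ≫ f' = 𝟙 Y') (_ : s ≫ f = 𝟙 Y)
    (w : f' ≫ y = x ≫ f) (_ : s' ≫ x = y ≫ s) :
    IsIso (kernel.map f' f x y w) → IsIso y → IsIso x

/-! ### Augmented simplicial objects -/

/-- The objects of the augmented simplicial category: the finite ordinals
`len = {0, …, len - 1}`, `len ≥ 0`. The ordinal `k + 1` sits in simplicial degree `k`. -/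
structure FinOrdinal where
  len : ℕ

/-- The augmented simplicial category: morphisms are the order-preserving functions. -/
instance : SmallCategory FinOrdinal where
  Hom a b := Fin a.len →o Fin b.len
  id _ := OrderHom.id
  comp f g := g.comp f

/-- An augmented simplicial object `X` of `D`. The object in simplicial degree `k ≥ -1` is
`X.obj (op ⟨k + 1⟩)`. -/
abbrev AugSimplicial (D : Type u) [Category.{v} D] := FinOrdinalᵒᵖ ⥤ D

/-- The injection `{0, …, k - 1} → {0, …, k}` whose image omits `i`. -/
def coface (k : ℕ) (i : Fin (k + 1)) : FinOrdinal.mk k ⟶ FinOrdinal.mk (k + 1) :=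
  (Fin.succAboveOrderEmb i).toOrderHom

theorem coface_comp (k : ℕ) (i j : Fin (k + 1)) (h : i ≤ j) :
    coface k i ≫ coface (k + 1) j.succ = coface k j ≫ coface (k + 1) i.castSucc := by
  apply OrderHom.ext
  funext x
  change j.succ.succAbove (i.succAbove x) = i.castSucc.succAbove (j.succAbove x)
  simp only [Fin.succAbove, Fin.lt_def, Fin.le_def, Fin.ext_iff] at *
  split_ifs <;> simp_all <;> omega

section Simplicial

variable {D : Type u} [Category.{v} D]

/-- The `i`-th face operator from simplicial degree `k` to simplicial degree `k - 1`. -/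
def face (X : AugSimplicial D) (k : ℕ) (i : Fin (k + 1)) :
    X.obj (op ⟨k + 1⟩) ⟶ X.obj (op ⟨k⟩) :=
  X.map (coface k i).op

/-- The simplicial identity `∂ᵢ ∂ⱼ₊₁ = ∂ⱼ ∂ᵢ` for `i ≤ j`. -/
theorem face_comp (X : AugSimplicial D) (k : ℕ) (i j : Fin (k + 1)) (h : i ≤ j) :
    face X (k + 1) j.succ ≫ face X k i = face X (k + 1) i.castSucc ≫ face X k j := by
  simp only [face, ← X.map_comp, ← op_comp, coface_comp k i j h]

theorem face_naturality {X Y : AugSimplicial D} (t : X ⟶ Y) (k : ℕ) (i : Fin (k + 1)) :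
    face X k i ≫ t.app (op ⟨k⟩) = t.app (op ⟨k + 1⟩) ≫ face Y k i :=
  t.naturality _

/-- `X` is (canonically) isomorphic to the coskeleton of its restriction to the finite ordinals
`≤ n`, that is, of its truncation at simplicial degree `n - 1`: it is the right Kan extension of
that restriction. -/
def IsCoskeletal (n : ℕ) (X : AugSimplicial D) : Prop :=
  let incl := (ObjectProperty.ι (fun a : FinOrdinal => a.len ≤ n)).op
  X.IsRightKanExtension (𝟙 (incl ⋙ X))

/-! ### Cycles and horns -/

variable [HasFiniteLimits D]

section FaceTuples

variable {n : ℕ} {X Y : D} (f : Fin n → (X ⟶ Y)) (S : Set (Fin (n + 1)))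

/-- The family of all `f_i x_l`, for `i < l` in `S` (here `l = j + 1` with `i ≤ j`). -/
def outer : (∏ᶜ fun _ : S => X) ⟶
    ∏ᶜ fun _ : {p : Fin n × Fin n // p.1 ≤ p.2 ∧ p.1.castSucc ∈ S ∧ p.2.succ ∈ S} => Y :=
  Pi.lift fun p => Pi.π (fun _ : S => X) ⟨p.1.2.succ, p.2.2.2⟩ ≫ f p.1.1

/-- The family of all `f_{l-1} x_i`, for `i < l` in `S` (here `l = j + 1` with `i ≤ j`). -/
def inner : (∏ᶜ fun _ : S => X) ⟶
    ∏ᶜ fun _ : {p : Fin n × Fin n // p.1 ≤ p.2 ∧ p.1.castSucc ∈ S ∧ p.2.succ ∈ S} => Y :=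
  Pi.lift fun p => Pi.π (fun _ : S => X) ⟨p.1.1.castSucc, p.2.2.1⟩ ≫ f p.1.2

/-- The universal object of tuples `(x_j)_{j ∈ S}`, `S ⊆ {0, …, n}`, in `X` that satisfy
`f_i x_l = f_{l-1} x_i` for all `i < l` in `S`. For `S = {0, …, n}` this is the simplicial kernel
of `(f_0, …, f_{n-1})`. -/
def faceTuples : D := equalizer (outer f S) (inner f S)

/-- The inclusion into the object of all tuples. -/
def faceTuples.incl : faceTuples f S ⟶ ∏ᶜ fun _ : S => X := equalizer.ι (outer f S) (inner f S)

theorem faceTuples.incl_condition :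
    faceTuples.incl f S ≫ outer f S = faceTuples.incl f S ≫ inner f S :=
  equalizer.condition _ _

/-- The entry `x_j`, `j ∈ S`. -/
def faceTuples.entry (j : Fin (n + 1)) (hj : j ∈ S) : faceTuples f S ⟶ X :=
  faceTuples.incl f S ≫ Pi.π (fun _ : S => X) ⟨j, hj⟩

theorem faceTuples.condition (i j : Fin n) (h : i ≤ j) (hi : i.castSucc ∈ S) (hj : j.succ ∈ S) :
    faceTuples.entry f S j.succ hj ≫ f i = faceTuples.entry f S i.castSucc hi ≫ f j := by
  have := congrArg (· ≫ Pi.π _ ⟨(i, j), h, hi, hj⟩) (faceTuples.incl_condition f S)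
  simp only [outer, inner, Category.assoc, Pi.lift_π] at this
  simp only [faceTuples.entry, Category.assoc]
  exact this

/-- The morphism induced by a compatible family. -/
def faceTuples.lift {W : D} (x : ∀ j : Fin (n + 1), j ∈ S → (W ⟶ X))
    (hx : ∀ (i j : Fin n) (_ : i ≤ j) (hi : i.castSucc ∈ S) (hj : j.succ ∈ S),
      x j.succ hj ≫ f i = x i.castSucc hi ≫ f j) : W ⟶ faceTuples f S :=
  equalizer.lift (Pi.lift fun j : S => x j.1 j.2) (by
    apply Pi.hom_ext
    rintro ⟨⟨i, j⟩, h, hi, hj⟩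
    simpa [outer, inner] using hx i j h hi hj)

theorem faceTuples.lift_entry {W : D} (x : ∀ j : Fin (n + 1), j ∈ S → (W ⟶ X))
    (hx : ∀ (i j : Fin n) (_ : i ≤ j) (hi : i.castSucc ∈ S) (hj : j.succ ∈ S),
      x j.succ hj ≫ f i = x i.castSucc hi ≫ f j) (j : Fin (n + 1)) (hj : j ∈ S) :
    faceTuples.lift f S x hx ≫ faceTuples.entry f S j hj = x j hj := by
  have h : faceTuples.lift f S x hx ≫ faceTuples.incl f S = Pi.lift fun j : S => x j.1 j.2 := equalizer.lift_ι _ _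
  rw [faceTuples.entry, ← Category.assoc, h, Pi.lift_π]

theorem faceTuples.hom_ext {W : D} (a b : W ⟶ faceTuples f S)
    (h : ∀ (j : Fin (n + 1)) (hj : j ∈ S),
      a ≫ faceTuples.entry f S j hj = b ≫ faceTuples.entry f S j hj) : a = b := by
  have : a ≫ faceTuples.incl f S = b ≫ faceTuples.incl f S := by
    apply Pi.hom_ext
    rintro ⟨j, hj⟩
    have := h j hj
    simp only [faceTuples.entry, ← Category.assoc] at this
    exact this
  exact equalizer.hom_ext this

end FaceTuples

/-- The object `Δ(X, n)` of `n`-cycles in `X`, `n ≥ 0`: the object in simplicial degree `-1` if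
`n = 0`, and the simplicial kernel of the faces `∂₀, …, ∂ₙ₋₁` from simplicial degree `n - 1` to
simplicial degree `n - 2` if `n ≥ 1`. -/
def cycles (X : AugSimplicial D) : ℕ → D
  | 0 => X.obj (op ⟨0⟩)
  | n + 1 => faceTuples (face X n) Set.univ

/-- The comparison morphism `(∂ᵢ)ᵢ` from the object in simplicial degree `n` to `Δ(X, n)`. -/
def boundary (X : AugSimplicial D) : ∀ n : ℕ, X.obj (op ⟨n + 1⟩) ⟶ cycles X n
  | 0 => face X 0 0
  | n + 1 => faceTuples.lift (face X n) Set.univ (fun j _ => face X (n + 1) j)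
      (fun i j h _ _ => face_comp X n i j h)

/-- `X` is a resolution of its object in simplicial degree `-1`. -/
def IsResolution (X : AugSimplicial D) : Prop :=
  ∀ n : ℕ, IsRegularEpi (boundary X n)

/-- The object of `(n + 1, i)`-horns in `X`, for `0 ≤ i ≤ n + 1`. When `n = 0` it consists of a
single entry in simplicial degree `0`, without conditions. -/
abbrev horn (X : AugSimplicial D) (n : ℕ) (i : Fin (n + 2)) : D :=
  faceTuples (face X n) {i}ᶜ

/-- The morphism from `(n + 1)`-cycles to `(n + 1, i)`-horns which forgets the `i`-th entry. -/
def cyclesToHorn (X : AugSimplicial D) (n : ℕ) (i : Fin (n + 2)) :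
    cycles X (n + 1) ⟶ horn X n i :=
  faceTuples.lift (face X n) {i}ᶜ
    (fun j _ => faceTuples.entry (face X n) Set.univ j (Set.mem_univ j))
    (fun j l h _ _ => faceTuples.condition (face X n) Set.univ j l h (Set.mem_univ _)
      (Set.mem_univ _))

/-- The morphism from the object in simplicial degree `n + 1` to the object of
`(n + 1, i)`-horns, given by all faces but the `i`-th one. -/
def toHorn (X : AugSimplicial D) (n : ℕ) (i : Fin (n + 2)) :
    X.obj (op ⟨n + 2⟩) ⟶ horn X n i :=
  faceTuples.lift (face X n) {i}ᶜ (fun j _ => face X (n + 1) j)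
    (fun j l h _ _ => face_comp X n j l h)

/-- The morphism between objects of `(n + 1, i)`-horns induced by a simplicial morphism. -/
def hornMap {X Y : AugSimplicial D} (t : X ⟶ Y) (n : ℕ) (i : Fin (n + 2)) :
    horn X n i ⟶ horn Y n i :=
  faceTuples.lift (face Y n) {i}ᶜ
    (fun j hj => faceTuples.entry (face X n) {i}ᶜ j hj ≫ t.app (op ⟨n + 1⟩))
    (fun j l h hj hl => by
      rw [Category.assoc, Category.assoc, ← face_naturality, ← face_naturality,
        ← Category.assoc, ← Category.assoc, faceTuples.condition _ _ j l h hj hl])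

theorem toHorn_naturality {X Y : AugSimplicial D} (t : X ⟶ Y) (n : ℕ) (i : Fin (n + 2)) :
    toHorn X n i ≫ hornMap t n i = t.app (op ⟨n + 2⟩) ≫ toHorn Y n i := by
  apply faceTuples.hom_ext
  intro j hj
  rw [Category.assoc, Category.assoc, hornMap, faceTuples.lift_entry, toHorn, toHorn,
    faceTuples.lift_entry, ← Category.assoc, faceTuples.lift_entry]
  exact face_naturality t (n + 1) j

/-- The comparison from the object of `X` in simplicial degree `n + 1` to the pullback of
`(n + 1, i)`-horns in `X` and `(n + 1)`-simplices in `Y` over `(n + 1, i)`-horns in `Y`. -/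
def kanComparison {X Y : AugSimplicial D} (t : X ⟶ Y) (n : ℕ) (i : Fin (n + 2)) :
    X.obj (op ⟨n + 2⟩) ⟶ pullback (hornMap t n i) (toHorn Y n i) :=
  pullback.lift (toHorn X n i) (t.app (op ⟨n + 2⟩)) (toHorn_naturality t n i)

/-- `t` satisfies the Kan condition in every simplicial degree `n + 1 ≥ 1`, for all `i`. -/
def IsFibration {X Y : AugSimplicial D} (t : X ⟶ Y) : Prop :=
  ∀ (n : ℕ) (i : Fin (n + 2)), IsRegularEpi (kanComparison t n i)

/-- `t` satisfies the Kan condition exactly in every simplicial degree `k + 1 ≥ n`, for all `i`. -/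
def IsExactFrom (n : ℕ) {X Y : AugSimplicial D} (t : X ⟶ Y) : Prop :=
  ∀ (k : ℕ) (i : Fin (k + 2)), n ≤ k + 1 → IsIso (kanComparison t k i)

end Simplicial

/-! ### The simplicial object `K(A, n)` and its torsors -/

section EilenbergMacLane

open MonObj

variable {D : Type u} [Category.{v} D] [CartesianMonoidalCategory D] [BraidedCategory D]

instance (k m : ℕ) : Finite (Fin k →o Fin m) := DFunLike.finite _

/-- The object of all functions from the `n`-simplices of the standard simplex with `m` vertices
(the order-preserving functions `{0, …, n} → {0, …, m - 1}`) to `A`. -/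
abbrev cochains (A : CommGrp D) (n m : ℕ) : D := ∏ᶜ fun _ : Fin (n + 1) →o Fin m => A.X

/-- The alternating sum `∑ᵢ (-1)ⁱ φ(g ∘ dᵢ)`, `0 ≤ i ≤ n + 1`, of the values of the universal
cochain `φ` on the faces of the `(n + 1)`-simplex `g`. The group of morphisms to `A` is written
multiplicatively. -/
def coboundary (A : CommGrp D) (n m : ℕ) (g : Fin (n + 2) →o Fin m) : cochains A n m ⟶ A.X :=
  ∏ i : Fin (n + 2),
    (Pi.π (fun _ : Fin (n + 1) →o Fin m => A.X) (g.comp (coface (n + 1) i))) ^ ((-1 : ℤ) ^ (i : ℕ))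

/-- The components of the condition that a cochain is normalised (zero on all degenerate
simplices) and that it is a cocycle. -/
def cocycleComponent (A : CommGrp D) (n m : ℕ) :
    {f : Fin (n + 1) →o Fin m // ¬ Function.Injective f} ⊕ (Fin (n + 2) →o Fin m) →
      (cochains A n m ⟶ A.X)
  | .inl f => Pi.π (fun _ : Fin (n + 1) →o Fin m => A.X) f.1
  | .inr g => coboundary A n m g

/-- Restriction of cochains along a simplicial operator. -/
def restrict (A : CommGrp D) (n : ℕ) {m k : ℕ} (θ : Fin k →o Fin m) :
    cochains A n m ⟶ cochains A n k :=
  Pi.lift fun f => Pi.π (fun _ : Fin (n + 1) →o Fin m => A.X) (θ.comp f)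

theorem restrict_cocycleComponent (A : CommGrp D) (n : ℕ) {m k : ℕ} (θ : Fin k →o Fin m)
    (s : {f : Fin (n + 1) →o Fin k // ¬ Function.Injective f} ⊕ (Fin (n + 2) →o Fin k)) :
    ∃ s', restrict A n θ ≫ cocycleComponent A n k s = cocycleComponent A n m s' := by
  rcases s with f | g
  · refine ⟨.inl ⟨θ.comp f.1, fun h => f.2 (Function.Injective.of_comp (f := θ) h)⟩, ?_⟩
    simp [restrict, cocycleComponent]
  · refine ⟨.inr (θ.comp g), ?_⟩
    simp only [cocycleComponent, coboundary]
    have key : ∀ s : Finset (Fin (n + 2)), restrict A n θ ≫ (∏ i ∈ s,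
        (Pi.π (fun _ : Fin (n + 1) →o Fin k => A.X) (g.comp (coface (n + 1) i))) ^
          ((-1 : ℤ) ^ (i : ℕ))) = ∏ i ∈ s,
        (Pi.π (fun _ : Fin (n + 1) →o Fin m => A.X) ((θ.comp g).comp (coface (n + 1) i))) ^
          ((-1 : ℤ) ^ (i : ℕ)) := by
      intro s
      induction s using Finset.induction_on with
      | empty => simp [MonObj.comp_one]
      | insert i s hi ih =>
        rw [Finset.prod_insert hi, Finset.prod_insert hi, MonObj.comp_mul, GrpObj.comp_zpow, ih,
          restrict, Pi.lift_π]
        rfl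
    exact key _

theorem restrict_id (A : CommGrp D) (n m : ℕ) :
    restrict A n (OrderHom.id : Fin m →o Fin m) = 𝟙 _ := by
  apply Pi.hom_ext
  intro f
  rw [restrict, Pi.lift_π, Category.id_comp]
  rfl

theorem restrict_comp (A : CommGrp D) (n : ℕ) {m k l : ℕ} (θ : Fin k →o Fin m)
    (ψ : Fin l →o Fin k) : restrict A n (θ.comp ψ) = restrict A n θ ≫ restrict A n ψ := by
  apply Pi.hom_ext
  intro f
  rw [restrict, restrict, restrict, Category.assoc, Pi.lift_π, Pi.lift_π, Pi.lift_π]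
  rfl

variable [HasFiniteLimits D]

/-- The object of normalised `n`-cocycles with values in `A` on the standard simplex with `m`
vertices. -/
def cocycles (A : CommGrp D) (n m : ℕ) : D :=
  equalizer (Pi.lift (cocycleComponent A n m)) (Pi.lift fun _ => (1 : cochains A n m ⟶ A.X))

/-- The inclusion of normalised cocycles into cochains. -/
def cocycles.incl (A : CommGrp D) (n m : ℕ) : cocycles A n m ⟶ cochains A n m :=
  equalizer.ι _ _

theorem cocycles.condition (A : CommGrp D) (n m : ℕ)
    (s : {f : Fin (n + 1) →o Fin m // ¬ Function.Injective f} ⊕ (Fin (n + 2) →o Fin m)) :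
    cocycles.incl A n m ≫ cocycleComponent A n m s = 1 := by
  have := congrArg (· ≫ Pi.π _ s) (equalizer.condition (Pi.lift (cocycleComponent A n m))
    (Pi.lift fun _ => (1 : cochains A n m ⟶ A.X)))
  simp only [Category.assoc, Pi.lift_π] at this
  exact this.trans (MonObj.comp_one _)

/-- Restriction of cocycles along a simplicial operator. -/
def cocycles.map (A : CommGrp D) (n : ℕ) {m k : ℕ} (θ : Fin k →o Fin m) :
    cocycles A n m ⟶ cocycles A n k :=
  equalizer.lift (cocycles.incl A n m ≫ restrict A n θ) (by
    apply Pi.hom_ext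
    intro s
    obtain ⟨s', h⟩ := restrict_cocycleComponent A n θ s
    rw [Category.assoc, Category.assoc, Category.assoc, Category.assoc, Pi.lift_π, Pi.lift_π, h,
      cocycles.condition, MonObj.comp_one, MonObj.comp_one])

theorem cocycles.map_incl (A : CommGrp D) (n : ℕ) {m k : ℕ} (θ : Fin k →o Fin m) :
    cocycles.map A n θ ≫ cocycles.incl A n k = cocycles.incl A n m ≫ restrict A n θ :=
  equalizer.lift_ι _ _

theorem cocycles.hom_ext (A : CommGrp D) (n m : ℕ) {W : D} (a b : W ⟶ cocycles A n m)
    (h : a ≫ cocycles.incl A n m = b ≫ cocycles.incl A n m) : a = b :=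
  equalizer.hom_ext h

/-- The augmented simplicial object `K(A, n)`, `n ≥ 1`, for an internal abelian group `A`: the
object in simplicial degree `k` is the object of normalised `n`-cocycles on the standard
`k`-simplex with values in `A`. So it is terminal in degrees `< n`, it is `A` in degree `n` (the
value on the nondegenerate `n`-simplex), and in degree `n + 1` it is `Aⁿ⁺¹`, where the faces
`∂₀, …, ∂ₙ` are the projections and the cocycle condition says that
`∂ₙ₊₁ = (-1)ⁿ ∑ᵢ (-1)ⁱ prᵢ`. A compatible family of cocycles on all faces of
dimension `≤ n + 1` is a cocycle, so it is the coskeleton of its truncation at degree `n + 1`. -/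
def eilenbergMacLane (A : CommGrp D) (n : ℕ) : AugSimplicial D where
  obj m := cocycles A n m.unop.len
  map θ := cocycles.map A n θ.unop
  map_id m := cocycles.hom_ext A n _ _ _ (by
    rw [cocycles.map_incl, Category.id_comp]
    exact (congrArg (cocycles.incl A n m.unop.len ≫ ·) (restrict_id A n m.unop.len)).trans
      (Category.comp_id _))
  map_comp θ ψ := cocycles.hom_ext A n _ _ _ (by
    rw [cocycles.map_incl, Category.assoc, cocycles.map_incl, ← Category.assoc,
      cocycles.map_incl, Category.assoc]
    exact congrArg (cocycles.incl A n _ ≫ ·) (restrict_comp A n θ.unop ψ.unop))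

/-- A `K(A, n)`-torsor `(T, t)` in `D`: `t` is a fibration which is exact from degree `n` on, `T`
is the coskeleton of its truncation at degree `n - 1`, and `T` is a resolution of the terminal
object. -/
structure IsTorsor (A : CommGrp D) (n : ℕ) (T : AugSimplicial D)
    (t : T ⟶ eilenbergMacLane A n) : Prop where
  isFibration : IsFibration t
  isExactFrom : IsExactFrom n t
  isCoskeletal : IsCoskeletal n T
  isResolution : IsResolution T
  isTerminal_augmentation : Nonempty (IsTerminal (T.obj (op ⟨0⟩)))

end EilenbergMacLane

/-! ### Central extensions with respect to abelianisation -/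

section Central

variable {C : Type u} [Category.{v} C] [HasZeroMorphisms C] [HasFiniteLimits C]

/-- An abelian object: its identity Huq-commutes with itself. -/
def IsAbelianObject (A : C) : Prop :=
  ∃ φ : A ⨯ A ⟶ A, prod.lift (𝟙 A) 0 ≫ φ = 𝟙 A ∧ prod.lift 0 (𝟙 A) ≫ φ = 𝟙 A

/-- `η` is the unit of the reflection of `X` into the full subcategory of abelian objects. -/
def IsAbelianisation {X B : C} (η : X ⟶ B) : Prop :=
  IsAbelianObject B ∧ ∀ (A : C), IsAbelianObject A → ∀ g : X ⟶ A, ∃! h : B ⟶ A, η ≫ h = g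

/-- A trivial extension: a regular epimorphism whose naturality square with respect to
abelianisation is a pullback. -/
def IsTrivialExtension {X Y : C} (f : X ⟶ Y) : Prop :=
  IsRegularEpi f ∧ ∃ (X' Y' : C) (ηX : X ⟶ X') (ηY : Y ⟶ Y') (f' : X' ⟶ Y'),
    IsAbelianisation ηX ∧ IsAbelianisation ηY ∧ IsPullback f ηX ηY f'

/-- A central extension: a regular epimorphism whose pullback along some regular epimorphism is a
trivial extension. -/
def IsCentralExtension {X Y : C} (f : X ⟶ Y) : Prop :=
  IsRegularEpi f ∧ ∃ (W : C) (g : W ⟶ Y),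
    IsRegularEpi g ∧ IsTrivialExtension (pullback.snd f g)

/-- `f` is a product projection with kernel `A`: there is `p` such that `(p, f)` exhibits `X` as
the product of `A` and `Y`. -/
def IsProductProjectionWithKernel (A : C) {X Y : C} (f : X ⟶ Y) : Prop :=
  ∃ p : X ⟶ A, Nonempty (IsLimit (BinaryFan.mk p f))

/-- The morphism `k : A ⟶ X` is a kernel of `f`, for some `k`. -/
def HasKernelObject (A : C) {X Y : C} (f : X ⟶ Y) : Prop :=
  ∃ (k : A ⟶ X) (w : k ≫ f = 0), Nonempty (IsLimit (KernelFork.ofι k w))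

end Central

/-! ### Beck modules and torsors of an object by a module -/

section BeckModules

variable {C : Type u} [Category.{v} C] [HasFiniteLimits C]

attribute [local instance] Over.cartesianMonoidalCategory Over.braidedCategory

/-- A `Z`-module (Beck module over `Z`): an abelian group in the slice category over `Z`. -/
abbrev BeckModule (Z : C) := CommGrp (Over Z)

namespace BeckModule

variable {Z : C} (M : BeckModule Z)

/-- The semidirect product `(A, ξ) ⋊ Z`. -/
abbrev total : C := M.X.left

/-- The projection `(A, ξ) ⋊ Z ⟶ Z`. -/
abbrev proj : M.total ⟶ Z := M.X.hom

/-- The unit of the internal group structure, a section of the projection. -/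
def unit : Z ⟶ M.total := (MonObj.one (X := M.X)).left

variable [HasZeroMorphisms C]

/-- The abelian object `A` underlying the module `(A, ξ)`. -/
abbrev object : C := kernel M.proj

/-- The action `ξ` is trivial: `(A, ξ) ⋊ Z` is the product `A × Z`, with the product projection to
`Z`, the section `(0, 1)` of it and the kernel inclusion `(1, 0)`. -/
def IsTrivial : Prop :=
  ∃ e : M.total ≅ M.object ⨯ Z, e.hom ≫ prod.snd = M.proj ∧
    M.unit ≫ e.hom = prod.lift 0 (𝟙 Z) ∧ kernel.ι M.proj ≫ e.hom = prod.lift (𝟙 _) 0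

/-- The simplicial object `K((A, ξ), n)` in the slice category over `Z`. -/
def eilenbergMacLane (n : ℕ) : AugSimplicial (Over Z) := HigherTorsor.eilenbergMacLane M n

/-- `(T, t)` is an `n`-torsor of `Z` by `(A, ξ)`: a `K((A, ξ), n)`-torsor in the slice category. -/
def IsTorsor (n : ℕ) (T : AugSimplicial (Over Z)) (t : T ⟶ M.eilenbergMacLane n) : Prop :=
  HigherTorsor.IsTorsor M n T t

end BeckModule

end BeckModules

end HigherTorsor

end

open HigherTorsor

/-!
Write `N = n + 1`, `E = Δ(T, N)`, `Λ = Λⁱ(T, N)`, `l = (∂ᵢ)ᵢ : T_{N-1} ⟶ Δ(T, N-1)` and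
`π : B ⟶ Z` for the module, with unit `u : Z ⟶ B`. Everything follows from two pullback squares over
`E`.

* Since `T` is `(N-1)`-coskeletal, `T_N = E`. Since `K(M, N)` is terminal in degrees `< N` and is `B`
  in degree `N`, exactness of `t` in degree `N` says that `E` is the product of `Λ` and `B` in the
  slice category over `Z`, i.e. the pullback of `Λ ⟶ Z` and `π`
  (`BeckModule.IsTorsor.isPullback_cyclesToHorn`).
* In a cycle, the boundary of the `i`-th entry depends only on the other entries, and this entry may
  be replaced by any simplex with the same boundary. So `E ⟶ Λ` is also the pullback of `l` along a
  morphism `Λ ⟶ Δ(T, N-1)` (`isPullback_cycleEntry`), a regular epimorphism because a degeneracy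
  splits `∂ᵢ`.

The kernels of `l`, of `E ⟶ Λ` and of `π` are thus the same object `A`. If the action is trivial, then
`π` is a product projection, hence so is its pullback `E ⟶ Λ`. If `E ⟶ Λ` is a product projection
with kernel `A`, then it is a trivial extension, because abelianisation sends `A × Λ` to
`A × ab(Λ)`; as it is a pullback of `l` along a regular epimorphism, `l` is central. If `l` is
central, then its kernel Huq-commutes with the identity of `T_{N-1}`: this holds for a trivial
extension, and commutation descends along regular epimorphisms (`HuqCommute.descend`). The resulting
action of `A` on `T_{N-1}` lifts to `E`, where it makes `A` commute with the section `Λ ⟶ E` given by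
the unit; mapping to `B` and descending along `Λ ⟶ Z`, the kernel of `π` commutes with `u`, so that
`B ≅ A × Z` by the Split Short Five Lemma.

The semi-abelian background needed for this is that product injections are jointly epimorphic, that
reflexive relations are equivalence relations, and that coequalisers, and therefore abelianisations,
exist. The first two are instances of `isIso_of_mono_of_split`.
-/

noncomputable section

namespace HigherTorsor

attribute [local simp] prod.lift_fst prod.lift_snd prod.lift_fst_assoc prod.lift_snd_assoc
  pullback.lift_fst pullback.lift_snd pullback.lift_fst_assoc pullback.lift_snd_assoc
  coprod.inl_desc coprod.inr_desc coprod.inl_desc_assoc coprod.inr_desc_assoc equalizer.lift_ι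

/-! ### Joint epimorphy, reflexive relations and coequalisers in semi-abelian categories -/

section SemiAbelianCategories

variable {C : Type u} [Category.{v} C] [HasZeroMorphisms C] [SemiAbelian C]

/-- A subobject of the domain of a split epimorphism which contains both the kernel and a section
is everything, by the Split Short Five Lemma. -/
theorem isIso_of_mono_of_split {S P Q : C} (m : S ⟶ P) [Mono m] (f : P ⟶ Q) (s : Q ⟶ P)
    (hs : s ≫ f = 𝟙 Q) (s' : Q ⟶ S) (hs' : s' ≫ m = s) (k : kernel f ⟶ S)
    (hk : k ≫ m = kernel.ι f) : IsIso m := by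
  refine SemiAbelian.split_short_five (m ≫ f) s' f s m (𝟙 Q) (by rw [← Category.assoc, hs', hs]) hs
    (by simp) (by simp [hs']) ?_ inferInstance
  refine ⟨kernel.lift _ k (by rw [← Category.assoc, hk, kernel.condition]), ?_, ?_⟩
  · apply (cancel_mono (kernel.ι (m ≫ f))).1
    apply (cancel_mono m).1
    simp [hk]
  · apply (cancel_mono (kernel.ι f)).1
    simp [hk]

/-- The two injections into a product are jointly epimorphic (semi-abelian categories are
unital). -/
theorem prod_hom_ext {X Y W : C} {f g : X ⨯ Y ⟶ W}
    (hX : prod.lift (𝟙 X) 0 ≫ f = prod.lift (𝟙 X) 0 ≫ g)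
    (hY : prod.lift 0 (𝟙 Y) ≫ f = prod.lift 0 (𝟙 Y) ≫ g) : f = g := by
  have key : kernel.ι (prod.snd : X ⨯ Y ⟶ Y) =
      (kernel.ι (prod.snd : X ⨯ Y ⟶ Y) ≫ prod.fst) ≫ prod.lift (𝟙 X) 0 := by
    apply Limits.prod.hom_ext <;> simp
  have : IsIso (equalizer.ι f g) := isIso_of_mono_of_split _ (prod.snd : X ⨯ Y ⟶ Y)
    (prod.lift 0 (𝟙 Y)) (by simp) (equalizer.lift _ hY) (by simp)
    ((kernel.ι (prod.snd : X ⨯ Y ⟶ Y) ≫ prod.fst) ≫ equalizer.lift _ hX) (by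
      rw [Category.assoc, equalizer.lift_ι, ← key])
  exact eq_of_epi_equalizer

/-- A reflexive relation `R` is difunctional: `x R y`, `z R y` and `z R w` imply `x R w`. The
relation `x R w` holds on the kernel of the projection which forgets `x`, where `z = y = w = 0`, and
on the section `x = z` of this projection, so it holds throughout by `isIso_of_mono_of_split`. -/
theorem exists_difunctional_of_reflexiveRelation {R X : C} {p q : R ⟶ X}
    (h : ReflexiveRelation p q) {W : C} (a b c : W ⟶ R) (hab : a ≫ q = b ≫ q)
    (hbc : b ≫ p = c ≫ p) : ∃ d : W ⟶ R, d ≫ p = a ≫ p ∧ d ≫ q = c ≫ q := by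
  -- `P` is the object of composable zigzags `x R y`, `z R y`, `z R w`, with `A`, `B`, `D` the three
  -- pairs, and `P₂` that of the last two pairs.
  let P₂ := pullback p p
  let P := pullback (pullback.snd q q) (pullback.fst p p)
  let A : P ⟶ R := pullback.fst _ _ ≫ pullback.fst q q
  let B : P ⟶ R := pullback.snd _ _ ≫ pullback.fst p p
  let D : P ⟶ R := pullback.snd _ _ ≫ pullback.snd p p
  have hAB : A ≫ q = B ≫ q := by
    simp only [A, B, Category.assoc]
    rw [← reassoc_of% (pullback.condition (f := pullback.snd q q) (g := pullback.fst p p)),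
      pullback.condition]
  have lift : ∀ {V : C} (x y z : V ⟶ R), x ≫ q = y ≫ q → y ≫ p = z ≫ p →
      ∃ t : V ⟶ P, t ≫ A = x ∧ t ≫ B = y ∧ t ≫ D = z := by
    intro V x y z h₁ h₂
    exact ⟨pullback.lift (pullback.lift x y h₁) (pullback.lift y z h₂) (by simp),
      by simp [A], by simp [B], by simp [D]⟩
  -- `S` consists of the zigzags in `P` for which `x R w` holds.
  let S := pullback (prod.lift (A ≫ p) (D ≫ q)) (prod.lift p q)
  have : Mono (prod.lift p q) := ⟨fun x y hxy => h.right_cancellation _ _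
    (by simpa using hxy =≫ prod.fst) (by simpa using hxy =≫ prod.snd)⟩
  have liftS : ∀ {V : C} (t : V ⟶ P) (d : V ⟶ R), d ≫ p = t ≫ A ≫ p → d ≫ q = t ≫ D ≫ q →
      ∃ t' : V ⟶ S, t' ≫ pullback.fst _ _ = t := by
    intro V t d h₁ h₂
    exact ⟨pullback.lift t d (by apply Limits.prod.hom_ext <;> simp [h₁, h₂]), by simp⟩
  -- the section of the projection `P ⟶ P₂`
  obtain ⟨s, hsA, hsB, hsD⟩ := lift (pullback.fst p p) (pullback.fst p p) (pullback.snd p p) rfl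
    pullback.condition
  have hs : s ≫ pullback.snd _ _ = 𝟙 P₂ := by
    apply pullback.hom_ext
    · rw [Category.assoc]; exact hsB.trans (Category.id_comp _).symm
    · rw [Category.assoc]; exact hsD.trans (Category.id_comp _).symm
  obtain ⟨s', hs'⟩ := liftS s (pullback.snd p p) (by rw [← Category.assoc, hsA, pullback.condition])
    (by rw [← Category.assoc, hsD])
  -- the kernel of the projection `P ⟶ P₂`
  let κ := kernel.ι (pullback.snd (pullback.snd q q) (pullback.fst p p))
  have hκB : κ ≫ B = 0 := by simp only [κ, B, kernel.condition_assoc, zero_comp]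
  have hκD : κ ≫ D = 0 := by simp only [κ, D, kernel.condition_assoc, zero_comp]
  obtain ⟨k, hk⟩ := liftS κ (κ ≫ A) (by simp) (by
    rw [Category.assoc, hAB, ← Category.assoc, hκB, ← Category.assoc, hκD])
  have hiso : IsIso (pullback.fst _ _ : S ⟶ P) := isIso_of_mono_of_split _ _ s hs s' hs' k hk
  obtain ⟨t, htA, htB, htD⟩ := lift a b c hab hbc
  refine ⟨t ≫ inv (pullback.fst _ _ : S ⟶ P) ≫ pullback.snd _ _, ?_, ?_⟩
  · have := (pullback.condition (f := prod.lift (A ≫ p) (D ≫ q)) (g := prod.lift p q)) =≫ prod.fst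
    simp only [Category.assoc, prod.lift_fst] at this
    simp only [Category.assoc, ← this, IsIso.inv_hom_id_assoc]
    rw [← Category.assoc, htA]
  · have := (pullback.condition (f := prod.lift (A ≫ p) (D ≫ q)) (g := prod.lift p q)) =≫ prod.snd
    simp only [Category.assoc, prod.lift_snd] at this
    simp only [Category.assoc, ← this, IsIso.inv_hom_id_assoc]
    rw [← Category.assoc, htD]

/-- Semi-abelian categories are Mal'tsev: reflexive relations are equivalence relations. -/
theorem isEquivalenceRelation_of_reflexiveRelation {R X : C} {p q : R ⟶ X}
    (h : ReflexiveRelation p q) : IsEquivalenceRelation p q := by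
  -- From `x R y`: `y R y`, `x R y` and `x R x` give `y R x`.
  obtain ⟨s, hs₁, hs₂⟩ := exists_difunctional_of_reflexiveRelation h (q ≫ h.r) (𝟙 R) (p ≫ h.r)
    (by simp) (by simp)
  -- From `x R y` and `y R w`: `x R y`, `y R y` and `y R w` give `x R w`.
  obtain ⟨t, ht₁, ht₂⟩ := exists_difunctional_of_reflexiveRelation h (pullback.fst q p)
    (pullback.fst q p ≫ q ≫ h.r) (pullback.snd q p) (by simp) (by simp [pullback.condition])
  exact ⟨⟨{ h with
    s := s
    symmetry₁ := by simpa using hs₁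
    symmetry₂ := by simpa using hs₂
    c := PullbackCone.mk _ _ pullback.condition
    isLimit := pullbackIsPullback q p
    t := t
    transitivity₁ := ht₁
    transitivity₂ := ht₂ }⟩⟩

/-- Coequalisers exist: the image of `(f, 1), (g, 1) : X + V ⟶ V` is a reflexive relation on `V`,
hence an equivalence relation, hence the kernel pair of a regular epimorphism. -/
theorem exists_coequalizer {X V : C} (f g : X ⟶ V) :
    ∃ (Q : C) (q : V ⟶ Q), IsRegularEpi q ∧ f ≫ q = g ≫ q ∧
      ∀ {W : C} (w : V ⟶ W), f ≫ w = g ≫ w → ∃ h : Q ⟶ W, q ≫ h = w := by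
  let d : X ⨿ V ⟶ V ⨯ V := prod.lift (coprod.desc f (𝟙 V)) (coprod.desc g (𝟙 V))
  let F := Regular.strongEpiMonoFactorisation d
  have : IsRegularEpi F.e := inferInstanceAs (IsRegularEpi (Regular.strongEpiMonoFactorisation d).e)
  let p := F.m ≫ prod.fst
  let q := F.m ≫ prod.snd
  have hp : F.e ≫ p = coprod.desc f (𝟙 V) := by simp [p, d]
  have hq : F.e ≫ q = coprod.desc g (𝟙 V) := by simp [q, d]
  have hR : ReflexiveRelation p q :=
    { right_cancellation := fun Y a b h₁ h₂ => by
        apply (cancel_mono F.m).1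
        apply Limits.prod.hom_ext
        · simpa [p] using h₁
        · simpa [q] using h₂
      r := coprod.inr ≫ F.e
      reflexivity₁ := by rw [Category.assoc, hp, coprod.inr_desc]
      reflexivity₂ := by rw [Category.assoc, hq, coprod.inr_desc] }
  obtain ⟨Y, y, hy⟩ := SemiAbelian.exists_isKernelPair p q
    (isEquivalenceRelation_of_reflexiveRelation hR)
  let G := Regular.strongEpiMonoFactorisation y
  have : IsRegularEpi G.e := inferInstanceAs (IsRegularEpi (Regular.strongEpiMonoFactorisation y).e)
  have hG : IsKernelPair G.e p q := by
    have : IsKernelPair (G.e ≫ G.m) p q := by rwa [G.fac]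
    exact this.cancel_right_of_mono
  refine ⟨G.I, G.e, inferInstance, ?_, ?_⟩
  · have := coprod.inl ≫= F.e ≫= hG.w
    rw [reassoc_of% hp, reassoc_of% hq] at this
    simpa using this
  · intro W w hw
    refine IsRegularEpi.exists_of_isKernelPair G.e hG w ?_
    apply (cancel_epi F.e).1
    rw [reassoc_of% hp, reassoc_of% hq]
    apply coprod.hom_ext <;> simp [hw]

end SemiAbelianCategories

/-! ### Huq-commuting morphisms and abelianisation -/

section HuqCommuting

variable {C : Type u} [Category.{v} C]

/-- The universal property of the product, in terms of morphisms from an arbitrary object. -/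
theorem isProductProjectionWithKernel_iff {A X Y : C} {f : X ⟶ Y} :
    IsProductProjectionWithKernel A f ↔ ∃ p : X ⟶ A,
      (∀ {W : C} (a : W ⟶ A) (y : W ⟶ Y), ∃ x : W ⟶ X, x ≫ p = a ∧ x ≫ f = y) ∧
      ∀ {W : C} (x x' : W ⟶ X), x ≫ p = x' ≫ p → x ≫ f = x' ≫ f → x = x' := by
  constructor
  · rintro ⟨p, ⟨hl⟩⟩
    exact ⟨p, fun a y => ⟨(BinaryFan.IsLimit.lift' hl a y).1,
      (BinaryFan.IsLimit.lift' hl a y).2.1, (BinaryFan.IsLimit.lift' hl a y).2.2⟩,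
      fun x x' h₁ h₂ => BinaryFan.IsLimit.hom_ext hl h₁ h₂⟩
  · rintro ⟨p, lift, ext⟩
    exact ⟨p, ⟨BinaryFan.IsLimit.mk _ (fun a y => (lift a y).choose)
      (fun a y => (lift a y).choose_spec.1) (fun a y => (lift a y).choose_spec.2)
      (fun a y m h₁ h₂ => ext _ _ (h₁.trans (lift a y).choose_spec.1.symm)
        (h₂.trans (lift a y).choose_spec.2.symm))⟩⟩

theorem IsProductProjectionWithKernel.of_isPullback {A X Y X' Y' : C} {f : X ⟶ Y}
    {f' : X' ⟶ Y'} {a : X' ⟶ X} {b : Y' ⟶ Y} (h : IsPullback a f' f b)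
    (hf : IsProductProjectionWithKernel A f) : IsProductProjectionWithKernel A f' := by
  obtain ⟨p, lift, ext⟩ := isProductProjectionWithKernel_iff.1 hf
  refine isProductProjectionWithKernel_iff.2 ⟨a ≫ p, fun x y => ?_, fun x x' h₁ h₂ => ?_⟩
  · obtain ⟨w, hw₁, hw₂⟩ := lift x (y ≫ b)
    exact ⟨h.lift w y hw₂, by simp [hw₁], by simp⟩
  · refine h.hom_ext (ext _ _ (by simpa using h₁) ?_) h₂
    rw [Category.assoc, Category.assoc, h.w, reassoc_of% h₂]

variable [HasZeroMorphisms C] [SemiAbelian C]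

/-- Two morphisms with the same codomain Huq-commute: they extend to a morphism on the product of
their domains. -/
def HuqCommute {K P X : C} (k : K ⟶ X) (g : P ⟶ X) : Prop :=
  ∃ φ : K ⨯ P ⟶ X, prod.lift (𝟙 K) 0 ≫ φ = k ∧ prod.lift 0 (𝟙 P) ≫ φ = g

theorem lift_zero_left {W K P : C} (a : W ⟶ P) :
    prod.lift (0 : W ⟶ K) a = a ≫ prod.lift 0 (𝟙 P) := by
  apply Limits.prod.hom_ext <;> simp

theorem lift_zero_right {W K P : C} (a : W ⟶ K) :
    prod.lift a (0 : W ⟶ P) = a ≫ prod.lift (𝟙 K) 0 := by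
  apply Limits.prod.hom_ext <;> simp

theorem HuqCommute.symm {K P X : C} {k : K ⟶ X} {g : P ⟶ X} (h : HuqCommute k g) :
    HuqCommute g k := by
  obtain ⟨φ, h₁, h₂⟩ := h
  refine ⟨prod.lift prod.snd prod.fst ≫ φ, ?_, ?_⟩
  · rw [← h₂, ← Category.assoc]
    congr 1
    apply Limits.prod.hom_ext <;> simp
  · rw [← h₁, ← Category.assoc]
    congr 1
    apply Limits.prod.hom_ext <;> simp

theorem HuqCommute.comp {K P X Y : C} {k : K ⟶ X} {g : P ⟶ X} (h : HuqCommute k g) (f : X ⟶ Y) :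
    HuqCommute (k ≫ f) (g ≫ f) := by
  obtain ⟨φ, h₁, h₂⟩ := h
  exact ⟨φ ≫ f, by rw [← Category.assoc, h₁], by rw [← Category.assoc, h₂]⟩

theorem HuqCommute.precomp {K P X Q : C} {k : K ⟶ X} {g : P ⟶ X} (h : HuqCommute k g)
    (f : Q ⟶ P) : HuqCommute k (f ≫ g) := by
  obtain ⟨φ, h₁, h₂⟩ := h
  refine ⟨prod.map (𝟙 K) f ≫ φ, ?_, ?_⟩
  · rw [← Category.assoc, ← h₁]
    congr 1
    apply Limits.prod.hom_ext <;> simp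
  · rw [← h₂, ← Category.assoc, ← Category.assoc]
    congr 1
    apply Limits.prod.hom_ext <;> simp

theorem isRegularEpi_prod_map {K P T : C} (e : P ⟶ T) [IsRegularEpi e] :
    IsRegularEpi (prod.map (𝟙 K) e) := by
  have h : IsPullback (prod.map (𝟙 K) e) prod.snd prod.snd e :=
    IsPullback.of_isLimit' ⟨by simp⟩ (PullbackCone.IsLimit.mk _
      (fun s => prod.lift (s.fst ≫ prod.fst) s.snd)
      (fun s => by
        apply Limits.prod.hom_ext
        · simp
        · simpa using s.condition.symm)
      (fun s => by simp)
      (fun s m h₁ h₂ => by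
        apply Limits.prod.hom_ext
        · simp [← h₁]
        · simp [← h₂]))
  exact Regular.regularEpiIsStableUnderBaseChange.of_isPullback h.flip
    (inferInstanceAs (IsRegularEpi e))

/-- Huq-commutation descends along a regular epimorphism. -/
theorem HuqCommute.descend {K P T X : C} {k : K ⟶ X} (e : P ⟶ T) [IsRegularEpi e] {g : T ⟶ X}
    (h : HuqCommute k (e ≫ g)) : HuqCommute k g := by
  obtain ⟨φ, h₁, h₂⟩ := h
  have := isRegularEpi_prod_map (K := K) e
  let E := prod.map (𝟙 K) e
  have hc : pullback.fst E E ≫ φ = pullback.snd E E ≫ φ := by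
    have h₃ : pullback.fst E E ≫ prod.fst = pullback.snd E E ≫ prod.fst := by
      simpa [E] using pullback.condition (f := E) (g := E) =≫ prod.fst
    have h₄ : (pullback.fst E E ≫ prod.snd) ≫ e = (pullback.snd E E ≫ prod.snd) ≫ e := by
      simpa [E] using pullback.condition (f := E) (g := E) =≫ prod.snd
    -- The kernel pair of `1 × e` is the product of `K` and the kernel pair of `e`, where the two
    -- composites with `φ` agree on both factors.
    have h₅ : prod.map (𝟙 K) (pullback.fst e e) ≫ φ = prod.map (𝟙 K) (pullback.snd e e) ≫ φ := by
      apply prod_hom_ext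
      · rw [← Category.assoc, ← Category.assoc]
        congr 1
        apply Limits.prod.hom_ext <;> simp
      · have h₆ : ∀ a : pullback e e ⟶ P, prod.lift 0 (𝟙 (pullback e e)) ≫ prod.map (𝟙 K) a ≫ φ =
            a ≫ e ≫ g := by
          intro a
          rw [← h₂, ← Category.assoc, ← Category.assoc]
          congr 1
          apply Limits.prod.hom_ext <;> simp
        rw [h₆, h₆, pullback.condition_assoc]
    have h₇ := prod.lift (pullback.fst E E ≫ prod.fst) (pullback.lift _ _ h₄) ≫= h₅
    rw [← Category.assoc, ← Category.assoc] at h₇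
    convert h₇ using 2
    · apply Limits.prod.hom_ext <;> simp
    · apply Limits.prod.hom_ext <;> simp [h₃]
  obtain ⟨ψ, hψ⟩ := IsRegularEpi.exists_of_isKernelPair E (IsKernelPair.of_hasPullback E) φ hc
  refine ⟨ψ, ?_, ?_⟩
  · rw [← h₁, ← hψ, ← Category.assoc]
    congr 1
    apply Limits.prod.hom_ext <;> simp [E]
  · apply (cancel_epi e).1
    rw [← h₂, ← hψ, ← Category.assoc, ← Category.assoc]
    congr 1
    apply Limits.prod.hom_ext <;> simp [E]

/-- The abelianisation of `Y` is obtained from the coequaliser `q` of the two injections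
`Y ⟶ Y × Y`, by restricting `q` along either of them. The resulting morphism `η` Huq-commutes with
itself, with `q` as a witness; as it is a regular epimorphism, the same follows for the identity. -/
theorem exists_isAbelianisation (Y : C) : ∃ (Q : C) (η : Y ⟶ Q), IsAbelianisation η := by
  obtain ⟨Q, q, hq, h, hu⟩ := exists_coequalizer (prod.lift (𝟙 Y) 0) (prod.lift 0 (𝟙 Y))
  let η := prod.lift (𝟙 Y) 0 ≫ q
  have hη : HuqCommute η η := ⟨q, rfl, h.symm⟩
  -- A subobject through which `η` factors pulls back along `q` to one that contains both injections.
  have hstrong : ∀ {S : C} (a : Y ⟶ S) (m : S ⟶ Q) [Mono m], a ≫ m = η → IsIso m := by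
    intro S a m _ ham
    have h₁ : ∃ b : Y ⨯ Y ⟶ S, b ≫ m = q := by
      have : IsIso (pullback.fst q m) := isIso_of_mono_of_split _ (prod.snd : Y ⨯ Y ⟶ Y)
        (prod.lift 0 (𝟙 Y)) (by simp)
        (pullback.lift (prod.lift 0 (𝟙 Y)) a (by rw [ham, ← h])) (by simp)
        (pullback.lift (kernel.ι _) (kernel.ι _ ≫ prod.fst ≫ a) (by
          rw [Category.assoc, Category.assoc, ham, ← Category.assoc, ← Category.assoc]
          congr 1
          apply Limits.prod.hom_ext <;> simp)) (by simp)
      exact ⟨inv (pullback.fst q m) ≫ pullback.snd q m, by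
        rw [Category.assoc, ← pullback.condition, IsIso.inv_hom_id_assoc]⟩
    obtain ⟨b, hb⟩ := h₁
    have : StrongEpi (b ≫ m) := by rw [hb]; infer_instance
    have : StrongEpi m := strongEpi_of_strongEpi b m
    exact isIso_of_mono_of_strongEpi m
  have hreg : IsRegularEpi η := by
    let F := Regular.strongEpiMonoFactorisation η
    have h₁ : IsIso F.m := hstrong F.e F.m F.fac
    have h₂ : StrongEpi η := by
      rw [← F.fac]
      exact strongEpi_comp _ _
    infer_instance
  have hab : HuqCommute (𝟙 Q) (𝟙 Q) := by
    apply HuqCommute.descend η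
    apply HuqCommute.symm
    apply HuqCommute.descend η
    simpa using hη
  refine ⟨Q, η, hab, ?_⟩
  rintro A ⟨φ, h₁, h₂⟩ g
  have h₃ : prod.lift (𝟙 Y) 0 ≫ prod.map g g = g ≫ prod.lift (𝟙 A) 0 := by
    apply Limits.prod.hom_ext <;> simp
  obtain ⟨w, hw⟩ := hu (prod.map g g ≫ φ) (by
    rw [← Category.assoc, ← Category.assoc]
    have h₄ : prod.lift 0 (𝟙 Y) ≫ prod.map g g = g ≫ prod.lift 0 (𝟙 A) := by
      apply Limits.prod.hom_ext <;> simp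
    rw [h₃, h₄, Category.assoc, Category.assoc, h₁, h₂])
  have hηw : η ≫ w = g := by
    rw [Category.assoc, hw, ← Category.assoc, h₃, Category.assoc, h₁, Category.comp_id]
  exact ⟨w, hηw, fun y hy => (cancel_epi η).1 (hy.trans hηw.symm)⟩

theorem IsAbelianObject.prod {A B : C} (hA : IsAbelianObject A) (hB : IsAbelianObject B) :
    IsAbelianObject (A ⨯ B) := by
  obtain ⟨φ, h₁, h₂⟩ := hA
  obtain ⟨ψ, h₃, h₄⟩ := hB
  have e₁ : ∀ {W : C} (a : W ⟶ A), prod.lift a 0 ≫ φ = a := fun a => by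
    rw [lift_zero_right, Category.assoc, h₁, Category.comp_id]
  have e₂ : ∀ {W : C} (a : W ⟶ A), prod.lift 0 a ≫ φ = a := fun a => by
    rw [lift_zero_left, Category.assoc, h₂, Category.comp_id]
  have e₃ : ∀ {W : C} (a : W ⟶ B), prod.lift a 0 ≫ ψ = a := fun a => by
    rw [lift_zero_right, Category.assoc, h₃, Category.comp_id]
  have e₄ : ∀ {W : C} (a : W ⟶ B), prod.lift 0 a ≫ ψ = a := fun a => by
    rw [lift_zero_left, Category.assoc, h₄, Category.comp_id]
  refine ⟨prod.lift (prod.map prod.fst prod.fst ≫ φ) (prod.map prod.snd prod.snd ≫ ψ), ?_, ?_⟩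
  · apply Limits.prod.hom_ext <;> simp [e₁, e₃]
  · apply Limits.prod.hom_ext <;> simp [e₂, e₄]

/-- The projection of a product with abelian kernel is a trivial extension: abelianisation maps
`A × Y` to `A × Y'`, where `Y'` is the abelianisation of `Y`. -/
theorem IsProductProjectionWithKernel.isTrivialExtension {A X Y : C} (hA : IsAbelianObject A)
    {f : X ⟶ Y} (hf : IsProductProjectionWithKernel A f) : IsTrivialExtension f := by
  obtain ⟨p, lift, ext⟩ := isProductProjectionWithKernel_iff.1 hf
  obtain ⟨Y', ηY, hY⟩ := exists_isAbelianisation Y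
  obtain ⟨s, hs₁, hs₂⟩ := lift (0 : Y ⟶ A) (𝟙 Y)
  obtain ⟨i, hi₁, hi₂⟩ := lift (𝟙 A) (0 : A ⟶ Y)
  have : IsSplitEpi f := ⟨⟨⟨s, hs₂⟩⟩⟩
  refine ⟨inferInstance, A ⨯ Y', Y', prod.lift p (f ≫ ηY), ηY, prod.snd, ⟨hA.prod hY.1, ?_⟩, hY, ?_⟩
  · rintro B ⟨φ, h₁, h₂⟩ g
    obtain ⟨g₂, hg₂, hu⟩ := hY.2 B ⟨φ, h₁, h₂⟩ (s ≫ g)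
    -- both factorisations are determined on the two factors of the product
    have hX : ∀ {W : C} (a b : X ⟶ W), i ≫ a = i ≫ b → s ≫ a = s ≫ b → a = b := by
      intro W a b h₃ h₄
      obtain ⟨e, he₁, he₂⟩ := lift (prod.fst : A ⨯ Y ⟶ A) (prod.snd : A ⨯ Y ⟶ Y)
      have hle : prod.lift p f ≫ e = 𝟙 X := by
        apply ext <;> simp [he₁, he₂]
      have hi : prod.lift (𝟙 A) 0 ≫ e = i := by
        apply ext <;> simp [he₁, he₂, hi₁, hi₂]
      have hs : prod.lift 0 (𝟙 Y) ≫ e = s := by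
        apply ext <;> simp [he₁, he₂, hs₁, hs₂]
      have : e ≫ a = e ≫ b := by
        apply prod_hom_ext
        · rw [← Category.assoc, hi, h₃, ← hi, Category.assoc]
        · rw [← Category.assoc, hs, h₄, ← hs, Category.assoc]
      rw [← Category.id_comp a, ← Category.id_comp b, ← hle, Category.assoc, this, Category.assoc]
    have hiη : i ≫ prod.lift p (f ≫ ηY) = prod.lift (𝟙 A) 0 := by
      apply Limits.prod.hom_ext <;> simp [hi₁, reassoc_of% hi₂]
    have hsη : s ≫ prod.lift p (f ≫ ηY) = ηY ≫ prod.lift 0 (𝟙 Y') := by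
      apply Limits.prod.hom_ext <;> simp [hs₁, reassoc_of% hs₂]
    have hm₁ : prod.lift (𝟙 A) 0 ≫ prod.map (i ≫ g) g₂ ≫ φ = i ≫ g := by
      have : prod.lift (𝟙 A) (0 : A ⟶ Y') ≫ prod.map (i ≫ g) g₂ =
          (i ≫ g) ≫ prod.lift (𝟙 B) 0 := by
        apply Limits.prod.hom_ext <;> simp
      rw [← Category.assoc, this, Category.assoc, h₁, Category.comp_id]
    have hm₂ : prod.lift 0 (𝟙 Y') ≫ prod.map (i ≫ g) g₂ ≫ φ = g₂ := by
      have : prod.lift (0 : Y' ⟶ A) (𝟙 Y') ≫ prod.map (i ≫ g) g₂ = g₂ ≫ prod.lift 0 (𝟙 B) := by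
        apply Limits.prod.hom_ext <;> simp
      rw [← Category.assoc, this, Category.assoc, h₂, Category.comp_id]
    refine ⟨prod.map (i ≫ g) g₂ ≫ φ, ?_, ?_⟩
    · apply hX
      · rw [← Category.assoc, hiη, hm₁]
      · rw [← Category.assoc, hsη, Category.assoc, hm₂, hg₂]
    · intro h hh
      apply prod_hom_ext
      · rw [hm₁, ← hiη, Category.assoc, hh]
      · rw [hm₂]
        apply hu
        rw [← Category.assoc, ← hsη, Category.assoc, hh]
  · refine IsPullback.of_isLimit' ⟨by simp⟩ (PullbackCone.IsLimit.mk _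
      (fun s => (lift (s.snd ≫ prod.fst) s.fst).choose)
      (fun s => (lift (s.snd ≫ prod.fst) s.fst).choose_spec.2)
      (fun s => ?_) (fun t m h₃ h₄ => ?_))
    · have := (lift (s.snd ≫ prod.fst) s.fst).choose_spec
      apply Limits.prod.hom_ext
      · simpa using this.1
      · simp [reassoc_of% this.2, s.condition]
    · have := (lift (t.snd ≫ prod.fst) t.fst).choose_spec
      apply ext
      · rw [this.1, ← h₄]; simp
      · rw [this.2, h₃]

/-- The kernel of a trivial extension commutes with the identity, because this is so for
a morphism whose domain is abelian, and a trivial extension is a pullback of such a morphism. -/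
theorem IsTrivialExtension.huqCommute {X Y K : C} {f : X ⟶ Y} (hf : IsTrivialExtension f)
    (k : K ⟶ X) (hk : k ≫ f = 0) : HuqCommute k (𝟙 X) := by
  obtain ⟨-, X', Y', ηX, ηY, f', ⟨⟨φ, h₁, h₂⟩, -⟩, -, hp⟩ := hf
  have e₁ : ∀ {W : C} (a : W ⟶ X'), prod.lift a 0 ≫ φ = a := fun a => by
    rw [lift_zero_right, Category.assoc, h₁, Category.comp_id]
  have e₂ : ∀ {W : C} (a : W ⟶ X'), prod.lift 0 a ≫ φ = a := fun a => by
    rw [lift_zero_left, Category.assoc, h₂, Category.comp_id]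
  have hkη : k ≫ ηX ≫ f' = 0 := by rw [← hp.w, reassoc_of% hk, zero_comp]
  -- `k` and `x` are sent to the element of `X = Y ×_{Y'} X'` over `f x` given by `k + x` in `X'`.
  refine ⟨hp.lift (prod.snd ≫ f) (prod.map (k ≫ ηX) ηX ≫ φ) ?_, ?_, ?_⟩
  · apply prod_hom_ext
    · simp [reassoc_of% e₁, hkη]
    · simp [reassoc_of% e₂, hp.w]
  · apply hp.hom_ext <;> simp [e₁, hk]
  · apply hp.hom_ext <;> simp [e₂]

/-- The kernel of a central extension commutes with the identity, by descent from the trivial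
extension along the regular epimorphism between the domains. -/
theorem IsCentralExtension.huqCommute {X Y K : C} {f : X ⟶ Y} (hf : IsCentralExtension f)
    (k : K ⟶ X) (hk : k ≫ f = 0) : HuqCommute k (𝟙 X) := by
  obtain ⟨-, W, g, hg, ht⟩ := hf
  have h := ht.huqCommute (pullback.lift k (0 : K ⟶ W) (by simp [hk])) (by simp)
  apply HuqCommute.descend (pullback.fst f g)
  simpa using h.comp (pullback.fst f g)

end HuqCommuting

/-! ### Centrality of a kernel across two pullback squares -/

section KernelsAndCentrality

variable {C : Type u} [Category.{v} C] [HasZeroMorphisms C] [SemiAbelian C]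

/-- If the kernel and a section of a split epimorphism Huq-commute, then they exhibit its domain as
a product, by the Split Short Five Lemma. -/
theorem exists_iso_prod_of_huqCommute {B Z : C} (π : B ⟶ Z) (η : Z ⟶ B) (hη : η ≫ π = 𝟙 Z)
    (h : HuqCommute (kernel.ι π) η) :
    ∃ e : B ≅ kernel π ⨯ Z, e.hom ≫ prod.snd = π ∧ η ≫ e.hom = prod.lift 0 (𝟙 Z) ∧
      kernel.ι π ≫ e.hom = prod.lift (𝟙 _) 0 := by
  obtain ⟨ψ, h₁, h₂⟩ := h
  have hψ : ψ ≫ π = prod.snd := by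
    apply prod_hom_ext
    · rw [← Category.assoc, h₁]; simp
    · rw [← Category.assoc, h₂]; simp [hη]
  have : IsIso ψ := by
    refine SemiAbelian.split_short_five prod.snd (prod.lift 0 (𝟙 Z)) π η ψ (𝟙 Z) (by simp) hη
      (by simp [hψ]) (by simp [h₂]) ?_ inferInstance
    refine ⟨kernel.lift _ (prod.lift (𝟙 _) 0) (by simp), ?_, ?_⟩
    · apply (cancel_mono (kernel.ι _)).1
      have h₃ : kernel.map (prod.snd : kernel π ⨯ Z ⟶ Z) π ψ (𝟙 Z) (by simp [hψ]) =
          kernel.ι _ ≫ prod.fst := by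
        apply (cancel_mono (kernel.ι π)).1
        have h₄ : kernel.ι (prod.snd : kernel π ⨯ Z ⟶ Z) =
            (kernel.ι (prod.snd : kernel π ⨯ Z ⟶ Z) ≫ prod.fst) ≫ prod.lift (𝟙 _) 0 := by
          apply Limits.prod.hom_ext <;> simp
        rw [kernel.lift_ι]
        conv_lhs => rw [h₄]
        rw [Category.assoc, h₁]
      rw [h₃]
      apply Limits.prod.hom_ext <;> simp
    · apply (cancel_mono (kernel.ι _)).1
      simp [h₁]
  refine ⟨(asIso ψ).symm, ?_, ?_, ?_⟩
  · simp [← hψ]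
  · simp [← h₂]
  · apply (cancel_mono ψ).1
    simp [h₁]

theorem IsProductProjectionWithKernel.of_iso_prod {A B Z : C} {π : B ⟶ Z} (e : B ≅ A ⨯ Z)
    (he : e.hom ≫ prod.snd = π) : IsProductProjectionWithKernel A π := by
  refine isProductProjectionWithKernel_iff.2 ⟨e.hom ≫ prod.fst,
    fun x y => ⟨prod.lift x y ≫ e.inv, by simp, by simp [← he]⟩, fun x x' h₁ h₂ => ?_⟩
  rw [← he] at h₂
  apply (cancel_mono e.hom).1
  apply Limits.prod.hom_ext
  · simpa using h₁
  · simpa using h₂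

variable {B Z E T L D : C} {π : B ⟶ Z} {e : E ⟶ T} {c : E ⟶ L} {l : T ⟶ D} {b : E ⟶ B}
  {z : L ⟶ Z} {m : L ⟶ D}

/-- A morphism and its pullback have the same kernel, so `l` and `π` have the same kernel if they
have a common pullback `c`. -/
theorem hasKernelObject_of_isPullback (h : IsPullback c b z π) (h' : IsPullback e c l m) :
    HasKernelObject (kernel π) l := by
  have hk := h.lift_fst 0 (kernel.ι π) (by simp)
  refine ⟨h.lift 0 (kernel.ι π) (by simp) ≫ e, by rw [Category.assoc, h'.w, reassoc_of% hk,
    zero_comp], ⟨KernelFork.IsLimit.ofι _ _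
      (fun x hx => kernel.lift π (h'.lift x 0 (by simp [hx]) ≫ b)
        (by rw [Category.assoc, ← h.w]; simp)) ?_ ?_⟩⟩
  · intro W x hx
    have : kernel.lift π (h'.lift x 0 (by simp [hx]) ≫ b) (by rw [Category.assoc, ← h.w]; simp) ≫
        h.lift 0 (kernel.ι π) (by simp) = h'.lift x 0 (by simp [hx]) := by
      apply h.hom_ext <;> simp
    rw [reassoc_of% this]
    simp
  · intro W x hx y hy
    apply (cancel_mono (kernel.ι π)).1
    rw [kernel.lift_ι]
    have : y ≫ h.lift 0 (kernel.ι π) (by simp) = h'.lift x 0 (by simp [hx]) := by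
      apply h'.hom_ext
      · simpa using hy
      · simp
    rw [← this]
    simp

/-- The action of the kernel of the central extension `l` on `T` restricts to an action on the
pullback `E`, and this gives the commutation of the kernel of `π` with its section. -/
theorem huqCommute_of_isCentralExtension (h : IsPullback c b z π) (h' : IsPullback e c l m)
    [IsRegularEpi z] (η : Z ⟶ B) (hη : η ≫ π = 𝟙 Z) (hl : IsCentralExtension l) :
    HuqCommute (kernel.ι π) η := by
  let k : kernel π ⟶ E := h.lift 0 (kernel.ι π) (by simp)
  have hkc : k ≫ c = 0 := h.lift_fst _ _ _
  have hkb : k ≫ b = kernel.ι π := h.lift_snd _ _ _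
  let s : L ⟶ E := h.lift (𝟙 L) (z ≫ η) (by simp [hη])
  have hsc : s ≫ c = 𝟙 L := h.lift_fst _ _ _
  have hsb : s ≫ b = z ≫ η := h.lift_snd _ _ _
  have hkl : (k ≫ e) ≫ l = 0 := by rw [Category.assoc, h'.w, reassoc_of% hkc, zero_comp]
  obtain ⟨φ, h₁, h₂⟩ := (hl.huqCommute (k ≫ e) hkl).precomp (s ≫ e)
  have hks : HuqCommute k s := by
    refine ⟨h'.lift φ prod.snd ?_, ?_, ?_⟩
    · apply prod_hom_ext
      · rw [reassoc_of% h₁]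
        simpa using hkl
      · rw [reassoc_of% h₂]
        simp [h'.w, reassoc_of% hsc]
    · apply h'.hom_ext
      · simp [h₁]
      · simp [hkc]
    · apply h'.hom_ext
      · simp [h₂]
      · simp [hsc]
  apply HuqCommute.descend z
  simpa [hkb, hsb] using hks.comp b

theorem IsProductProjectionWithKernel.isCentralExtension {A : C} (hA : IsAbelianObject A)
    (h' : IsPullback e c l m) [IsRegularEpi l] [IsRegularEpi m]
    (hc : IsProductProjectionWithKernel A c) : IsCentralExtension l := by
  refine ⟨inferInstance, L, m, inferInstance, ?_⟩
  apply IsProductProjectionWithKernel.isTrivialExtension hA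
  exact IsProductProjectionWithKernel.of_isPullback
    (a := h'.isoPullback.inv) (b := 𝟙 L) (IsPullback.of_horiz_isIso ⟨by simp⟩) hc

end KernelsAndCentrality

/-! ### The abelian object underlying a module -/

section BeckModuleKernels

variable {C : Type u} [Category.{v} C] [HasZeroMorphisms C] [SemiAbelian C]

attribute [local instance] Over.cartesianMonoidalCategory Over.braidedCategory

open MonObj

variable {Z : C} (M : BeckModule Z)

theorem BeckModule.unit_proj : M.unit ≫ M.proj = 𝟙 Z :=
  Over.w (MonObj.one (X := M.X))

theorem one_left {W : Over Z} : (1 : W ⟶ M.X).left = W.hom ≫ M.unit := by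
  have : (1 : W ⟶ M.X) = CartesianMonoidalCategory.toUnit W ≫ MonObj.one := rfl
  rw [this, Over.comp_left]
  congr 1

/-- The multiplication of the module restricts to the kernel of its projection. -/
theorem BeckModule.isAbelianObject_object : IsAbelianObject M.object := by
  let i : ∀ {W : C} (x : W ⟶ M.object), Over.mk (0 : W ⟶ Z) ⟶ M.X := fun x =>
    Over.homMk (x ≫ kernel.ι M.proj) (by simp)
  have hi : ∀ {W V : C} (x : W ⟶ M.object) (a : V ⟶ W),
      (Over.homMk a (by simp) : Over.mk (0 : V ⟶ Z) ⟶ Over.mk (0 : W ⟶ Z)) ≫ i x = i (a ≫ x) := by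
    intro W V x a
    apply Over.OverMorphism.ext
    simp [i]
  have hi₀ : ∀ {W : C}, i (0 : W ⟶ M.object) = 1 := by
    intro W
    apply Over.OverMorphism.ext
    rw [one_left]
    simp [i]
  let q := i (prod.fst : M.object ⨯ M.object ⟶ _) * i prod.snd
  have hq : q.left ≫ M.proj = 0 := Over.w q
  have key : ∀ a : M.object ⟶ M.object ⨯ M.object, (i (a ≫ prod.fst) * i (a ≫ prod.snd)).left =
      a ≫ q.left := by
    intro a
    rw [← hi, ← hi, ← MonObj.comp_mul]
    rfl
  refine ⟨kernel.lift _ q.left hq, ?_, ?_⟩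
  · apply (cancel_mono (kernel.ι M.proj)).1
    rw [Category.assoc, kernel.lift_ι, ← key]
    simp [hi₀, i]
  · apply (cancel_mono (kernel.ι M.proj)).1
    rw [Category.assoc, kernel.lift_ι, ← key]
    simp [hi₀, i]

end BeckModuleKernels

/-! ### Coskeletal simplicial objects, cycles and horns -/

section Ordinals

theorem coface_injective {a : FinOrdinal} {k : ℕ} (i : Fin (k + 1)) {ψ ψ' : a ⟶ FinOrdinal.mk k}
    (h : ψ ≫ coface k i = ψ' ≫ coface k i) : ψ = ψ' := by
  apply OrderHom.ext
  funext x
  exact Fin.succAbove_right_injective (p := i) (congrArg (fun f => OrderHom.toFun f x) h)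

theorem exists_comp_coface {a : FinOrdinal} {k : ℕ} (i : Fin (k + 1))
    (θ : a ⟶ FinOrdinal.mk (k + 1)) (hi : ∀ x, OrderHom.toFun θ x ≠ i) :
    ∃ ψ : a ⟶ FinOrdinal.mk k, ψ ≫ coface k i = θ := by
  choose f hf using fun x => Fin.exists_succAbove_eq (hi x)
  refine ⟨⟨f, fun x y hxy => ?_⟩, OrderHom.ext _ _ (funext hf)⟩
  rw [← (Fin.strictMono_succAbove i).le_iff_le, hf, hf]
  exact θ.monotone hxy

theorem exists_factor_coface {a : FinOrdinal} {k : ℕ} (ha : a.len ≤ k)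
    (θ : a ⟶ FinOrdinal.mk (k + 1)) :
    ∃ (i : Fin (k + 1)) (ψ : a ⟶ FinOrdinal.mk k), ψ ≫ coface k i = θ := by
  have : ¬ Function.Surjective (OrderHom.toFun θ) := fun h => by
    have := Fintype.card_le_of_surjective _ h
    simp only [Fintype.card_fin] at this
    omega
  simp only [Function.Surjective, not_forall, not_exists] at this
  obtain ⟨i, hi⟩ := this
  exact ⟨i, exists_comp_coface i θ hi⟩

/-- The surjection `{0, …, k + 1} → {0, …, k}` which takes the value `i` twice. -/
def codegeneracy (k : ℕ) (i : Fin (k + 1)) : FinOrdinal.mk (k + 2) ⟶ FinOrdinal.mk (k + 1) :=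
  (⟨i.predAbove, Fin.predAbove_right_monotone i⟩ : Fin (k + 2) →o Fin (k + 1))

theorem coface_codegeneracy (k : ℕ) (i : Fin (k + 1)) :
    coface (k + 1) i.castSucc ≫ codegeneracy k i = 𝟙 _ := by
  apply OrderHom.ext
  funext x
  exact Fin.predAbove_succAbove i x

theorem exists_castSucc_eq_succ {k : ℕ} (g : Fin (k + 2) →o Fin (k + 1)) :
    ∃ j : Fin (k + 1), g j.castSucc = g j.succ := by
  by_contra! h
  have hg : StrictMono g := Fin.strictMono_iff_lt_succ.2 fun j =>
    lt_of_le_of_ne (g.monotone (Fin.castSucc_lt_succ).le) (h j)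
  have := Fintype.card_le_of_injective _ hg.injective
  simp only [Fintype.card_fin] at this
  omega

theorem orderHom_eq_id {k : ℕ} (f : Fin k →o Fin k) (hf : Function.Injective f) :
    f = OrderHom.id := by
  have hs := f.monotone.strictMono_of_injective hf
  let e : Fin k ≃o Fin k := hs.orderIsoOfSurjective f (Finite.surjective_of_injective hf)
  have he : e = OrderIso.refl _ := Subsingleton.elim _ _
  apply OrderHom.ext
  funext x
  exact congrArg (fun e : Fin k ≃o Fin k => e x) he

end Ordinals

section Coskeleta

variable {D : Type u} [Category.{v} D]

/-- A compatible family of simplices on the faces of a simplex has a well-defined restriction along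
a simplicial operator, independent of the face through which the operator factors. -/
theorem compatible_face_congr (X : AugSimplicial D) {n : ℕ} {W : D}
    (x : Fin (n + 2) → (W ⟶ X.obj (op ⟨n + 1⟩)))
    (hx : ∀ i j : Fin (n + 1), i ≤ j → x j.succ ≫ face X n i = x i.castSucc ≫ face X n j)
    {a : FinOrdinal} (i j : Fin (n + 2)) (ψ ψ' : a ⟶ FinOrdinal.mk (n + 1))
    (h : ψ ≫ coface (n + 1) i = ψ' ≫ coface (n + 1) j) :
    x i ≫ X.map ψ.op = x j ≫ X.map ψ'.op := by
  wlog hij : i ≤ j generalizing i j ψ ψ'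
  · exact (this j i ψ' ψ h.symm (le_of_not_ge hij)).symm
  rcases hij.eq_or_lt with rfl | hij
  · rw [coface_injective i h]
  obtain ⟨i, rfl⟩ := Fin.exists_castSucc_eq.2 (ne_of_lt (hij.trans_le (Fin.le_last j)))
  obtain ⟨j, rfl⟩ := Fin.exists_succ_eq.2 (ne_of_gt ((Fin.zero_le _).trans_lt hij))
  have hij' : i ≤ j := Fin.castSucc_lt_succ_iff.1 hij
  -- The operator misses both `i` and `j + 1`, so it factors through their common face.
  have hs : i.castSucc.succAbove j = j.succ :=
    Fin.succAbove_of_le_castSucc _ _ (Fin.castSucc_le_castSucc_iff.2 hij')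
  obtain ⟨χ, hχ⟩ := exists_comp_coface j ψ (fun y hy => by
    have h₁ : i.castSucc.succAbove (OrderHom.toFun ψ y) = j.succ.succAbove (OrderHom.toFun ψ' y) :=
      congrArg (fun f => OrderHom.toFun f y) h
    rw [hy, hs] at h₁
    exact Fin.succAbove_ne _ _ h₁.symm)
  have hχ' : χ ≫ coface n i = ψ' := by
    apply coface_injective j.succ
    rw [Category.assoc, coface_comp n i j hij', ← Category.assoc, hχ, h]
  have h₂ := hx i j hij' =≫ X.map χ.op
  simp only [face, Category.assoc, ← X.map_comp, ← op_comp, hχ, hχ'] at h₂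
  exact h₂.symm

variable [HasFiniteLimits D]

/-- As the comma categories involved are finite, the right Kan extension which defines a coskeleton
is pointwise. -/
theorem IsCoskeletal.isLimit_nonempty {n : ℕ} {X : AugSimplicial D} (hX : IsCoskeletal n X)
    (Y : FinOrdinalᵒᵖ) : Nonempty (IsLimit ((Functor.RightExtension.mk X
      (𝟙 ((ObjectProperty.ι (fun a : FinOrdinal => a.len ≤ n)).op ⋙ X))).coneAt Y)) := by
  let incl := (ObjectProperty.ι (fun a : FinOrdinal => a.len ≤ n)).op
  have hX' : X.IsRightKanExtension (𝟙 (incl ⋙ X)) := hX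
  have : incl.HasPointwiseRightKanExtension (incl ⋙ X) := by
    intro Y
    have hf : Finite (StructuredArrow Y incl) := by
      have : Finite (Σ a : Fin (n + 1), Fin (a : ℕ) →o Fin Y.unop.len) := inferInstance
      refine Finite.of_injective (β := Σ a : Fin (n + 1), Fin (a : ℕ) →o Fin Y.unop.len)
        (fun g => ⟨⟨g.right.unop.obj.len, Nat.lt_succ_of_le g.right.unop.property⟩, g.hom.unop⟩) ?_
      rintro ⟨⟨⟨⟩⟩, ⟨⟨⟨a⟩, ha⟩⟩, f⟩ ⟨⟨⟨⟩⟩, ⟨⟨⟨b⟩, hb⟩⟩, g⟩ h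
      simp only [Sigma.mk.injEq, Fin.mk.injEq] at h
      obtain ⟨rfl, h⟩ := h
      have h' : f.unop = g.unop := eq_of_heq h
      have : f = g := Quiver.Hom.unop_inj h'
      rw [this]
    have hm : ∀ g g' : StructuredArrow Y incl, Finite (g ⟶ g') := fun g g' => by
      have : Finite (Fin g'.right.unop.obj.len →o Fin g.right.unop.obj.len) := inferInstance
      refine Finite.of_injective
        (β := Fin g'.right.unop.obj.len →o Fin g.right.unop.obj.len)
        (fun φ => φ.right.unop.hom) ?_
      intro φ φ' h
      apply StructuredArrow.ext
      apply Quiver.Hom.unop_inj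
      apply ObjectProperty.hom_ext
      exact h
    let _ : FinCategory (StructuredArrow Y incl) :=
      { fintypeObj := Fintype.ofFinite _
        fintypeHom := fun g g' => Fintype.ofFinite _ }
    change HasLimit (StructuredArrow.proj Y incl ⋙ incl ⋙ X)
    infer_instance
  exact ⟨Functor.isPointwiseRightKanExtensionOfIsRightKanExtension X (𝟙 (incl ⋙ X)) Y⟩

theorem IsCoskeletal.hom_ext {n : ℕ} {X : AugSimplicial D} (hX : IsCoskeletal n X) {W : D}
    {x y : W ⟶ X.obj (op ⟨n + 1⟩)} (h : ∀ i, x ≫ face X n i = y ≫ face X n i) : x = y := by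
  obtain ⟨hl⟩ := hX.isLimit_nonempty (op ⟨n + 1⟩)
  refine hl.hom_ext fun g => ?_
  obtain ⟨i, ψ, hψ⟩ := exists_factor_coface g.right.unop.property g.hom.unop
  have key : X.map g.hom = face X n i ≫ X.map ψ.op := by
    rw [face, ← X.map_comp, ← op_comp, hψ]
    rfl
  have e : ((Functor.RightExtension.mk X (𝟙 ((ObjectProperty.ι
      (fun a : FinOrdinal => a.len ≤ n)).op ⋙ X))).coneAt (op ⟨n + 1⟩)).π.app g = X.map g.hom :=
    Category.comp_id _
  rw [e]
  refine (congrArg (x ≫ ·) key).trans (Eq.trans ?_ (congrArg (y ≫ ·) key).symm)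
  exact (Category.assoc _ _ _).symm.trans ((congrArg (· ≫ X.map ψ.op) (h i)).trans
    (Category.assoc _ _ _))

theorem IsCoskeletal.exists_lift {n : ℕ} {X : AugSimplicial D} (hX : IsCoskeletal (n + 1) X) {W : D}
    (x : Fin (n + 2) → (W ⟶ X.obj (op ⟨n + 1⟩)))
    (hx : ∀ i j : Fin (n + 1), i ≤ j → x j.succ ≫ face X n i = x i.castSucc ≫ face X n j) :
    ∃ w : W ⟶ X.obj (op ⟨n + 2⟩), ∀ i, w ≫ face X (n + 1) i = x i := by
  obtain ⟨hl⟩ := hX.isLimit_nonempty (op ⟨n + 2⟩)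
  let incl := (ObjectProperty.ι (fun a : FinOrdinal => a.len ≤ n + 1)).op
  have hfac : ∀ g : StructuredArrow (op (FinOrdinal.mk (n + 2))) incl, ∃ (i : Fin (n + 2))
      (ψ : g.right.unop.obj ⟶ FinOrdinal.mk (n + 1)), ψ ≫ coface (n + 1) i = g.hom.unop :=
    fun g => exists_factor_coface g.right.unop.property g.hom.unop
  choose i ψ hψ using hfac
  let c : Cone (StructuredArrow.proj (op (FinOrdinal.mk (n + 2))) incl ⋙ incl ⋙ X) :=
    { pt := W
      π :=
        { app := fun g => x (i g) ≫ X.map (ψ g).op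
          naturality := fun g₁ g₂ φ => by
            have h₁ : g₂.hom.unop = φ.right.unop.hom ≫ g₁.hom.unop := by
              rw [← StructuredArrow.w φ]
              rfl
            have h₂ := compatible_face_congr X x hx (i g₂) (i g₁) (ψ g₂) (φ.right.unop.hom ≫ ψ g₁)
              (by rw [hψ, Category.assoc, hψ, h₁])
            refine (Category.id_comp _).trans (h₂.trans ?_)
            rw [op_comp, X.map_comp]
            exact (Category.assoc _ _ _).symm } }
  refine ⟨hl.lift c, fun j => ?_⟩
  let g : StructuredArrow (op (FinOrdinal.mk (n + 2))) incl :=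
    StructuredArrow.mk (Y := op ⟨FinOrdinal.mk (n + 1), le_rfl⟩) (coface (n + 1) j).op
  have h₁ := hl.fac c g
  have h₂ : x (i g) ≫ X.map (ψ g).op = x j ≫ X.map (𝟙 (FinOrdinal.mk (n + 1))).op :=
    compatible_face_congr X x hx _ _ _ _ ((hψ g).trans (Category.id_comp _).symm)
  rw [op_id, X.map_id, Category.comp_id] at h₂
  refine Eq.trans ?_ (h₁.trans h₂)
  exact congrArg (hl.lift c ≫ ·) (Category.comp_id _).symm

end Coskeleta

section CyclesAndHorns

variable {D : Type u} [Category.{v} D] [HasFiniteLimits D] (X : AugSimplicial D) {n : ℕ}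

/-- The entry `x_i` of the universal `(n + 1)`-cycle. -/
def cycleEntry (n : ℕ) (i : Fin (n + 2)) : cycles X (n + 1) ⟶ X.obj (op ⟨n + 1⟩) :=
  faceTuples.entry (face X n) Set.univ i (Set.mem_univ i)

variable {X} in
theorem cycles_hom_ext {W : D} {x y : W ⟶ cycles X (n + 1)}
    (h : ∀ i, x ≫ cycleEntry X n i = y ≫ cycleEntry X n i) : x = y :=
  faceTuples.hom_ext _ _ _ _ fun i _ => h i

theorem cycleEntry_face (i j : Fin (n + 1)) (h : i ≤ j) :
    cycleEntry X n j.succ ≫ face X n i = cycleEntry X n i.castSucc ≫ face X n j :=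
  faceTuples.condition (face X n) Set.univ i j h (Set.mem_univ _) (Set.mem_univ _)

theorem exists_cycle {W : D} (x : Fin (n + 2) → (W ⟶ X.obj (op ⟨n + 1⟩)))
    (hx : ∀ i j : Fin (n + 1), i ≤ j → x j.succ ≫ face X n i = x i.castSucc ≫ face X n j) :
    ∃ w : W ⟶ cycles X (n + 1), ∀ i, w ≫ cycleEntry X n i = x i :=
  ⟨faceTuples.lift (face X n) Set.univ (fun j _ => x j) (fun i j h _ _ => hx i j h),
    fun _ => faceTuples.lift_entry _ _ _ _ _ _⟩

theorem boundary_cycleEntry (n : ℕ) (j : Fin (n + 2)) :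
    boundary X (n + 1) ≫ cycleEntry X n j = face X (n + 1) j :=
  faceTuples.lift_entry (face X n) Set.univ (fun j _ => face X (n + 1) j)
    (fun i j h _ _ => face_comp X n i j h) j (Set.mem_univ j)

theorem comp_boundary_eq_iff (n : ℕ) {W : D} (x y : W ⟶ X.obj (op ⟨n + 1⟩)) :
    x ≫ boundary X n = y ≫ boundary X n ↔ ∀ i, x ≫ face X n i = y ≫ face X n i := by
  cases n with
  | zero =>
    refine ⟨fun h i => ?_, fun h => h 0⟩
    obtain rfl : i = 0 := Subsingleton.elim (α := Fin 1) i 0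
    exact h
  | succ n =>
    constructor
    · intro h i
      rw [← boundary_cycleEntry, reassoc_of% h]
    · intro h
      apply cycles_hom_ext
      intro j
      rw [Category.assoc, Category.assoc, boundary_cycleEntry, h]

variable {X} in
/-- In a coskeletal object, the simplices in the first degree above the truncation are the cycles. -/
theorem IsCoskeletal.isIso_boundary (hX : IsCoskeletal (n + 1) X) :
    IsIso (boundary X (n + 1)) := by
  obtain ⟨w, hw⟩ := hX.exists_lift (cycleEntry X n) (cycleEntry_face X)
  have h₁ : w ≫ boundary X (n + 1) = 𝟙 _ := by
    apply cycles_hom_ext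
    intro j
    rw [Category.assoc, boundary_cycleEntry, hw, Category.id_comp]
  refine ⟨w, hX.hom_ext fun i => ?_, h₁⟩
  rw [← boundary_cycleEntry, Category.assoc, reassoc_of% h₁, Category.id_comp]

theorem cyclesToHorn_entry (i j : Fin (n + 2)) (hj : j ∈ ({i}ᶜ : Set (Fin (n + 2)))) :
    cyclesToHorn X n i ≫ faceTuples.entry (face X n) {i}ᶜ j hj = cycleEntry X n j :=
  faceTuples.lift_entry (face X n) {i}ᶜ
    (fun j _ => faceTuples.entry (face X n) Set.univ j (Set.mem_univ j)) _ j hj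

theorem boundary_cyclesToHorn (i : Fin (n + 2)) :
    boundary X (n + 1) ≫ cyclesToHorn X n i = toHorn X n i := by
  apply faceTuples.hom_ext
  intro j hj
  rw [Category.assoc, cyclesToHorn_entry, boundary_cycleEntry, toHorn, faceTuples.lift_entry]

theorem comp_cyclesToHorn_eq_iff {W : D} (x y : W ⟶ cycles X (n + 1)) (i : Fin (n + 2)) :
    x ≫ cyclesToHorn X n i = y ≫ cyclesToHorn X n i ↔
      ∀ j, j ≠ i → x ≫ cycleEntry X n j = y ≫ cycleEntry X n j := by
  constructor
  · intro h j hj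
    rw [← cyclesToHorn_entry X i j hj, reassoc_of% h]
  · intro h
    apply faceTuples.hom_ext
    intro j hj
    rw [Category.assoc, Category.assoc, cyclesToHorn_entry, h j hj]

/-- The boundary of an entry of a cycle is determined by the other entries. -/
theorem comp_cycleEntry_boundary_eq {W : D} (x y : W ⟶ cycles X (n + 1)) (i : Fin (n + 2))
    (h : x ≫ cyclesToHorn X n i = y ≫ cyclesToHorn X n i) :
    x ≫ cycleEntry X n i ≫ boundary X n = y ≫ cycleEntry X n i ≫ boundary X n := by
  rw [comp_cyclesToHorn_eq_iff] at h
  rw [← Category.assoc, ← Category.assoc, comp_boundary_eq_iff]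
  intro k
  rw [Category.assoc, Category.assoc]
  rcases lt_or_ge k.castSucc i with hk | hk
  · obtain ⟨i, rfl⟩ := Fin.exists_succ_eq.2 (ne_of_gt ((Fin.zero_le _).trans_lt hk))
    rw [cycleEntry_face X k i (Fin.castSucc_lt_succ_iff.1 hk)]
    have h' := h _ hk.ne =≫ face X n i
    simpa only [Category.assoc] using h'
  · obtain ⟨i, rfl⟩ := Fin.exists_castSucc_eq.2
      (ne_of_lt (hk.trans_lt (Fin.castSucc_lt_last k)))
    rw [← cycleEntry_face X i k (Fin.castSucc_le_castSucc_iff.1 hk)]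
    have h' := h _ (Fin.castSucc_lt_succ_iff.2 (Fin.castSucc_le_castSucc_iff.1 hk)).ne' =≫ face X n i
    simpa only [Category.assoc] using h'

/-- An entry of a cycle may be replaced by any simplex with the same boundary. -/
theorem exists_cycle_replace {W : D} (x : W ⟶ cycles X (n + 1)) (i : Fin (n + 2))
    (y : W ⟶ X.obj (op ⟨n + 1⟩)) (h : y ≫ boundary X n = x ≫ cycleEntry X n i ≫ boundary X n) :
    ∃ x' : W ⟶ cycles X (n + 1), x' ≫ cycleEntry X n i = y ∧
      x' ≫ cyclesToHorn X n i = x ≫ cyclesToHorn X n i := by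
  rw [← Category.assoc, comp_boundary_eq_iff] at h
  let z : Fin (n + 2) → (W ⟶ X.obj (op ⟨n + 1⟩)) :=
    Function.update (fun j => x ≫ cycleEntry X n j) i y
  have hz : ∀ j k, z j ≫ face X n k = x ≫ cycleEntry X n j ≫ face X n k := by
    intro j k
    by_cases hj : j = i
    · subst hj
      simp [z, h]
    · simp [z, hj]
  obtain ⟨x', hx'⟩ := exists_cycle X z (fun a b hab => by
    rw [hz, hz, cycleEntry_face X a b hab])
  refine ⟨x', (hx' i).trans (by simp [z]), ?_⟩
  rw [comp_cyclesToHorn_eq_iff]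
  intro j hj
  rw [hx']
  simp [z, hj]

/-- For any section `s` of the projection from cycles to horns, the object of cycles is the
pullback of the object of horns and the object of simplices over the object of possible boundaries
of the missing face. -/
theorem isPullback_cycleEntry (i : Fin (n + 2)) (s : horn X n i ⟶ cycles X (n + 1))
    (hs : s ≫ cyclesToHorn X n i = 𝟙 _) :
    IsPullback (cycleEntry X n i) (cyclesToHorn X n i) (boundary X n)
      (s ≫ cycleEntry X n i ≫ boundary X n) := by
  have w : cycleEntry X n i ≫ boundary X n =
      cyclesToHorn X n i ≫ s ≫ cycleEntry X n i ≫ boundary X n := by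
    have := comp_cycleEntry_boundary_eq X (𝟙 _) (cyclesToHorn X n i ≫ s) i (by
      rw [Category.assoc, hs, Category.comp_id, Category.id_comp])
    simpa using this
  have hl : ∀ t : PullbackCone (boundary X n) (s ≫ cycleEntry X n i ≫ boundary X n),
      ∃ x : t.pt ⟶ cycles X (n + 1), x ≫ cycleEntry X n i = t.fst ∧
        x ≫ cyclesToHorn X n i = t.snd := by
    intro t
    obtain ⟨x, h₁, h₂⟩ := exists_cycle_replace X (t.snd ≫ s) i t.fst
      (by rw [t.condition, Category.assoc])
    exact ⟨x, h₁, by rw [h₂, Category.assoc, hs, Category.comp_id]⟩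
  refine IsPullback.of_isLimit' ⟨w⟩ (PullbackCone.IsLimit.mk _ (fun t => (hl t).choose)
    (fun t => (hl t).choose_spec.1) (fun t => (hl t).choose_spec.2) (fun t m h₁ h₂ => ?_))
  have h₃ := (comp_cyclesToHorn_eq_iff X _ _ i).1 (h₂.trans (hl t).choose_spec.2.symm)
  apply cycles_hom_ext
  intro j
  by_cases hji : j = i
  · subst hji
    exact h₁.trans (hl t).choose_spec.1.symm
  · exact h₃ j hji

/-- A degeneracy followed by the boundary splits every entry of a cycle but the last one. -/
theorem isSplitEpi_cycleEntry (i : Fin (n + 1)) : IsSplitEpi (cycleEntry X n i.castSucc) := by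
  refine ⟨⟨⟨X.map (codegeneracy n i).op ≫ boundary X (n + 1), ?_⟩⟩⟩
  rw [Category.assoc, boundary_cycleEntry, face, ← X.map_comp, ← op_comp,
    coface_codegeneracy, op_id, X.map_id]

end CyclesAndHorns

/-! ### The degrees at most `n` of the simplicial object `K(A, n)` -/

section EilenbergMacLaneObjects

open MonObj

variable {D : Type u} [Category.{v} D] [CartesianMonoidalCategory D] [BraidedCategory D]

theorem comp_coboundary (A : CommGrp D) (n m : ℕ) (g : Fin (n + 2) →o Fin m) {W : D}
    (w : W ⟶ cochains A n m) : w ≫ coboundary A n m g = ∏ i : Fin (n + 2),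
      (w ≫ Pi.π (fun _ : Fin (n + 1) →o Fin m => A.X) (g.comp (coface (n + 1) i))) ^
        ((-1 : ℤ) ^ (i : ℕ)) := by
  let F : (cochains A n m ⟶ A.X) →* (W ⟶ A.X) :=
    { toFun := fun a => w ≫ a
      map_one' := MonObj.comp_one w
      map_mul' := fun a b => MonObj.comp_mul w a b }
  refine (map_prod F _ _).trans (Finset.prod_congr rfl fun i _ => ?_)
  exact map_zpow F _ _

variable [HasFiniteLimits D]

/-- The value of the universal cocycle on an `n`-simplex of the standard simplex. -/
def cocycleValue (A : CommGrp D) (n : ℕ) {m : ℕ} (f : Fin (n + 1) →o Fin m) :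
    cocycles A n m ⟶ A.X :=
  cocycles.incl A n m ≫ Pi.π (fun _ : Fin (n + 1) →o Fin m => A.X) f

theorem cocycleValue_of_not_injective (A : CommGrp D) (n : ℕ) {m : ℕ} (f : Fin (n + 1) →o Fin m)
    (hf : ¬ Function.Injective f) : cocycleValue A n f = 1 :=
  cocycles.condition A n m (.inl ⟨f, hf⟩)

theorem cocycles_hom_ext (A : CommGrp D) (n : ℕ) {m : ℕ} {W : D} {a b : W ⟶ cocycles A n m}
    (h : ∀ f : Fin (n + 1) →o Fin m, Function.Injective f →
      a ≫ cocycleValue A n f = b ≫ cocycleValue A n f) : a = b := by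
  apply cocycles.hom_ext
  apply Pi.hom_ext
  intro f
  rw [Category.assoc, Category.assoc]
  change a ≫ cocycleValue A n f = b ≫ cocycleValue A n f
  by_cases hf : Function.Injective f
  · exact h f hf
  · rw [cocycleValue_of_not_injective A n f hf, MonObj.comp_one, MonObj.comp_one]

/-- Below degree `n`, the simplicial object `K(A, n)` is subterminal: all simplices of dimension
`n` are degenerate. -/
theorem cocycles_hom_eq (A : CommGrp D) (n : ℕ) {m : ℕ} (hm : m ≤ n) {W : D}
    (a b : W ⟶ cocycles A n m) : a = b :=
  cocycles_hom_ext A n fun f hf => by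
    have := Fintype.card_le_of_injective f hf
    simp only [Fintype.card_fin] at this
    omega

/-- The value of an `n`-simplex of `K(A, n)` on the nondegenerate `n`-simplex of the standard
`n`-simplex. -/
def fundamentalValue (A : CommGrp D) (n : ℕ) : (eilenbergMacLane A n).obj (op ⟨n + 1⟩) ⟶ A.X :=
  cocycleValue A n OrderHom.id

theorem fundamentalValue_ext (A : CommGrp D) (n : ℕ) {W : D}
    {a b : W ⟶ (eilenbergMacLane A n).obj (op ⟨n + 1⟩)}
    (h : a ≫ fundamentalValue A n = b ≫ fundamentalValue A n) : a = b :=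
  cocycles_hom_ext A n fun f hf => by rw [orderHom_eq_id f hf]; exact h

/-- In degree `n`, every value on the nondegenerate simplex is attained: an `(n + 1)`-simplex of
the standard `n`-simplex is degenerate, so that two faces of it agree and occur with opposite
signs, and all other faces are degenerate. -/
theorem exists_fundamentalValue_eq (A : CommGrp D) (n : ℕ) {W : D} (β : W ⟶ A.X) :
    ∃ a : W ⟶ (eilenbergMacLane A n).obj (op ⟨n + 1⟩), a ≫ fundamentalValue A n = β := by
  classical
  let φ : (Fin (n + 1) →o Fin (n + 1)) → (W ⟶ A.X) := fun f => if f = OrderHom.id then β else 1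
  have hφ : ∀ f : Fin (n + 1) →o Fin (n + 1), ¬ Function.Injective f → φ f = 1 := by
    intro f hf
    refine if_neg ?_
    rintro rfl
    exact hf fun _ _ h => h
  have hprod : ∀ g : Fin (n + 2) →o Fin (n + 1), ∏ i : Fin (n + 2),
      φ (g.comp (coface (n + 1) i)) ^ ((-1 : ℤ) ^ (i : ℕ)) = 1 := by
    intro g
    obtain ⟨j, hj⟩ := exists_castSucc_eq_succ g
    rw [Finset.prod_eq_mul_of_mem j.castSucc j.succ (Finset.mem_univ _) (Finset.mem_univ _)
      (Fin.castSucc_lt_succ).ne]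
    · have : g.comp (coface (n + 1) j.castSucc) = g.comp (coface (n + 1) j.succ) := by
        apply OrderHom.ext
        funext x
        change g (j.castSucc.succAbove x) = g (j.succ.succAbove x)
        rcases lt_trichotomy x j with h | rfl | h
        · rw [Fin.succAbove_castSucc_of_lt _ _ h, Fin.succAbove_succ_of_le _ _ h.le]
        · rw [Fin.succAbove_castSucc_self, Fin.succAbove_succ_self, hj]
        · rw [Fin.succAbove_castSucc_of_le _ _ h.le, Fin.succAbove_succ_of_lt _ _ h]
      rw [this, ← zpow_add, Fin.val_castSucc, Fin.val_succ, pow_succ]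
      simp
    · rintro i - ⟨h₁, h₂⟩
      rw [hφ, one_zpow]
      intro hinj
      obtain ⟨x, hx⟩ := Fin.exists_succAbove_eq h₁.symm
      obtain ⟨y, hy⟩ := Fin.exists_succAbove_eq h₂.symm
      have hxy : x = y := by
        apply hinj
        change g (i.succAbove x) = g (i.succAbove y)
        rw [hx, hy, hj]
      rw [hxy, hy] at hx
      exact (Fin.castSucc_lt_succ).ne' hx
  let c : W ⟶ cochains A n (n + 1) := Pi.lift φ
  have hc : ∀ s, c ≫ cocycleComponent A n (n + 1) s = 1 := by
    rintro (f | g)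
    · exact (Pi.lift_π _ _).trans (hφ f.1 f.2)
    · refine (comp_coboundary A n (n + 1) g c).trans (Eq.trans ?_ (hprod g))
      refine Finset.prod_congr rfl fun i _ => ?_
      rw [Pi.lift_π]
  have hc' : c ≫ Pi.lift (cocycleComponent A n (n + 1)) =
      c ≫ Pi.lift fun _ => (1 : cochains A n (n + 1) ⟶ A.X) := Pi.hom_ext _ _ fun s => by
    rw [Category.assoc, Category.assoc, Pi.lift_π, Pi.lift_π, hc, MonObj.comp_one]
  have hlift : equalizer.lift c hc' ≫ cocycles.incl A n (n + 1) = c := equalizer.lift_ι _ _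
  refine ⟨equalizer.lift c hc', ?_⟩
  refine (Category.assoc _ _ _).symm.trans ((congrArg (· ≫ Pi.π _ _) hlift).trans ?_)
  exact (Pi.lift_π _ _).trans (if_pos rfl)

variable {A : CommGrp D} {n : ℕ} {T : AugSimplicial D} {t : T ⟶ eilenbergMacLane A (n + 1)}

/-- The value in `A` of the fundamental cocycle of a torsor on an `(n + 1)`-cycle. -/
def IsTorsor.value (hT : IsTorsor A (n + 1) T t) : cycles T (n + 1) ⟶ A.X :=
  have := hT.isCoskeletal.isIso_boundary
  inv (boundary T (n + 1)) ≫ t.app (op ⟨n + 2⟩) ≫ fundamentalValue A (n + 1)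

theorem IsTorsor.boundary_value (hT : IsTorsor A (n + 1) T t) :
    boundary T (n + 1) ≫ hT.value =
      t.app (op ⟨n + 2⟩) ≫ fundamentalValue A (n + 1) := by
  have := hT.isCoskeletal.isIso_boundary
  rw [IsTorsor.value, IsIso.hom_inv_id_assoc]

theorem eilenbergMacLane_horn_hom_eq (i : Fin (n + 2)) {W : D}
    (a b : W ⟶ horn (eilenbergMacLane A (n + 1)) n i) : a = b :=
  faceTuples.hom_ext _ _ _ _ fun _ _ => cocycles_hom_eq A (n + 1) le_rfl _ _

/-- The object of cycles of a torsor is the product of `A` and the object of horns: a cycle is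
determined by a horn and an arbitrary value of the cocycle. -/
theorem IsTorsor.existsUnique_cycle (hT : IsTorsor A (n + 1) T t) (i : Fin (n + 2)) {W : D}
    (h : W ⟶ horn T n i) (β : W ⟶ A.X) :
    ∃! x : W ⟶ cycles T (n + 1), x ≫ cyclesToHorn T n i = h ∧ x ≫ hT.value = β := by
  have := hT.isCoskeletal.isIso_boundary
  have := hT.isExactFrom n i le_rfl
  obtain ⟨a, ha⟩ := exists_fundamentalValue_eq A (n + 1) β
  let y : W ⟶ pullback (hornMap t n i) (toHorn (eilenbergMacLane A (n + 1)) n i) :=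
    pullback.lift h a (eilenbergMacLane_horn_hom_eq i _ _)
  have hfst : kanComparison t n i ≫ pullback.fst _ _ = toHorn T n i := pullback.lift_fst _ _ _
  have hsnd : kanComparison t n i ≫ pullback.snd _ _ = t.app (op ⟨n + 2⟩) := pullback.lift_snd _ _ _
  refine ⟨y ≫ inv (kanComparison t n i) ≫ boundary T (n + 1), ⟨?_, ?_⟩, ?_⟩
  · rw [Category.assoc, Category.assoc, boundary_cyclesToHorn, ← hfst, IsIso.inv_hom_id_assoc]
    exact pullback.lift_fst _ _ _
  · rw [Category.assoc, Category.assoc, hT.boundary_value, ← hsnd, Category.assoc,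
      IsIso.inv_hom_id_assoc, ← Category.assoc, ← ha]
    congr 1
    exact pullback.lift_snd _ _ _
  · rintro x ⟨h₁, h₂⟩
    rw [← Category.assoc, ← IsIso.comp_inv_eq, IsIso.eq_comp_inv]
    apply pullback.hom_ext
    · rw [Category.assoc, hfst, ← boundary_cyclesToHorn, Category.assoc, IsIso.inv_hom_id_assoc, h₁]
      exact (pullback.lift_fst _ _ _).symm
    · rw [Category.assoc, hsnd]
      refine Eq.trans ?_ (pullback.lift_snd _ _ _).symm
      apply fundamentalValue_ext
      rw [ha, Category.assoc, Category.assoc, ← hT.boundary_value, IsIso.inv_hom_id_assoc, h₂]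

end EilenbergMacLaneObjects

section SliceCategories

variable {C : Type u} [Category.{v} C] {Z : C}

/-- Products in a slice category are pullbacks over the base. -/
theorem isPullback_left_of_existsUnique {E X Y : Over Z} (c : E ⟶ X) (b : E ⟶ Y)
    (h : ∀ {W : Over Z} (x : W ⟶ X) (y : W ⟶ Y), ∃! e : W ⟶ E, e ≫ c = x ∧ e ≫ b = y) :
    IsPullback c.left b.left X.hom Y.hom := by
  have hl : ∀ t : PullbackCone X.hom Y.hom, ∃ e : t.pt ⟶ E.left, e ≫ c.left = t.fst ∧
      e ≫ b.left = t.snd := by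
    intro t
    obtain ⟨e, ⟨h₁, h₂⟩, -⟩ := h (W := Over.mk (t.fst ≫ X.hom)) (Over.homMk t.fst)
      (Over.homMk t.snd t.condition.symm)
    exact ⟨e.left, congrArg CommaMorphism.left h₁, congrArg CommaMorphism.left h₂⟩
  have hu : ∀ {W : C} (e e' : W ⟶ E.left), e ≫ c.left = e' ≫ c.left → e ≫ b.left = e' ≫ b.left →
      e = e' := by
    intro W e e' h₁ h₂
    have he : e ≫ E.hom = e' ≫ E.hom := by rw [← Over.w c, reassoc_of% h₁]
    exact congrArg CommaMorphism.left ((h (W := Over.mk (e' ≫ E.hom)) (Over.homMk e' ≫ c)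
      (Over.homMk e' ≫ b)).unique (y₁ := Over.homMk e he) (y₂ := Over.homMk e')
      ⟨Over.OverMorphism.ext h₁, Over.OverMorphism.ext h₂⟩ ⟨rfl, rfl⟩)
  exact IsPullback.of_isLimit' ⟨by simp⟩ (PullbackCone.IsLimit.mk _ (fun t => (hl t).choose)
    (fun t => (hl t).choose_spec.1) (fun t => (hl t).choose_spec.2)
    (fun t m h₁ h₂ => hu _ _ (h₁.trans (hl t).choose_spec.1.symm)
      (h₂.trans (hl t).choose_spec.2.symm)))

theorem isRegularEpi_left [HasFiniteLimits C] {X Y : Over Z} (f : X ⟶ Y) [IsRegularEpi f] : IsRegularEpi f.left := by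
  let r := IsRegularEpi.getStruct f
  have w : r.left.left ≫ f.left = r.right.left ≫ f.left := congrArg CommaMorphism.left r.w
  exact ⟨⟨{ W := r.W.left
            left := r.left.left
            right := r.right.left
            w := w
            isColimit := isColimitCoforkMapOfIsColimit (Over.forget Z) r.w r.isColimit }⟩⟩

theorem isIso_hom_of_isTerminal {X : Over Z} (h : IsTerminal X) : IsIso X.hom := by
  let e := h.uniqueUpToIso Over.mkIdTerminal
  have : e.hom.left = X.hom := (Category.comp_id _).symm.trans (Over.w e.hom)
  rw [← this]
  exact inferInstanceAs (IsIso ((Over.forget Z).map e.hom))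

end SliceCategories

/-! ### Torsors over a base object -/

section TorsorsOverBase

open MonObj

variable {C : Type u} [Category.{v} C] [HasZeroMorphisms C] [SemiAbelian C]

attribute [local instance] Over.cartesianMonoidalCategory Over.braidedCategory

variable {Z : C} {M : BeckModule Z} {n : ℕ} {T : AugSimplicial (Over Z)}
  {t : T ⟶ M.eilenbergMacLane (n + 1)}

theorem isRegularEpi_of_comp {X Y W : C} (f : X ⟶ Y) (g : Y ⟶ W) [StrongEpi (f ≫ g)] :
    IsRegularEpi g := by
  have := strongEpi_of_strongEpi f g
  infer_instance

theorem BeckModule.IsTorsor.isPullback_cyclesToHorn (hT : M.IsTorsor (n + 1) T t)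
    (i : Fin (n + 2)) : IsPullback (cyclesToHorn T n i).left (IsTorsor.value hT).left
      (horn T n i).hom M.proj :=
  isPullback_left_of_existsUnique _ _ fun h β => IsTorsor.existsUnique_cycle hT i h β

theorem BeckModule.IsTorsor.isRegularEpi_boundary (hT : M.IsTorsor (n + 1) T t) (k : ℕ) :
    IsRegularEpi (boundary T k).left :=
  have := hT.isResolution k
  isRegularEpi_left _

/-- An object over `Z` which receives a morphism from `T₀` covers `Z`, because `T₀` does. -/
theorem BeckModule.IsTorsor.isRegularEpi_hom (hT : M.IsTorsor (n + 1) T t) {X : Over Z}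
    (f : T.obj (op ⟨1⟩) ⟶ X) : IsRegularEpi X.hom := by
  obtain ⟨h⟩ := hT.isTerminal_augmentation
  have hZ : IsIso (cycles T 0).hom := isIso_hom_of_isTerminal h
  have := hT.isRegularEpi_boundary 0
  have e : f.left ≫ X.hom = (boundary T 0).left ≫ (cycles T 0).hom :=
    (Over.w f).trans (Over.w (face T 0 0)).symm
  have : StrongEpi (f.left ≫ X.hom) := by
    rw [e]
    exact strongEpi_comp _ _
  exact isRegularEpi_of_comp f.left X.hom

theorem BeckModule.IsTorsor.isRegularEpi_horn_hom (hT : M.IsTorsor (n + 1) T t)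
    (i : Fin (n + 2)) : IsRegularEpi (horn T n i).hom :=
  hT.isRegularEpi_hom (T.map (Quiver.Hom.op
    (⟨fun _ => 0, monotone_const⟩ : Fin (n + 2) →o Fin 1)) ≫ toHorn T n i)

/-- The unit of the module provides a section of the morphism from cycles to horns, and hence
a description of this morphism as a pullback of the extension `boundary T n`. -/
theorem BeckModule.IsTorsor.exists_isPullback (hT : M.IsTorsor (n + 1) T t) (i : Fin (n + 1)) :
    ∃ m : (horn T n i.castSucc).left ⟶ (cycles T n).left, IsRegularEpi m ∧
      IsPullback (cycleEntry T n i.castSucc).left (cyclesToHorn T n i.castSucc).left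
        (boundary T n).left m := by
  obtain ⟨s, ⟨hs, -⟩, -⟩ := IsTorsor.existsUnique_cycle hT i.castSucc (𝟙 _) 1
  let m : (horn T n i.castSucc).left ⟶ (cycles T n).left :=
    (s ≫ cycleEntry T n i.castSucc ≫ boundary T n).left
  have hp : IsPullback (cycleEntry T n i.castSucc).left (cyclesToHorn T n i.castSucc).left
      (boundary T n).left m := (isPullback_cycleEntry T i.castSucc s hs).map (Over.forget Z)
  refine ⟨m, ?_, hp⟩
  have := isSplitEpi_cycleEntry T i
  have := hT.isRegularEpi_boundary n
  have : IsSplitEpi (cycleEntry T n i.castSucc).left :=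
    inferInstanceAs (IsSplitEpi ((Over.forget Z).map (cycleEntry T n i.castSucc)))
  have : StrongEpi ((cyclesToHorn T n i.castSucc).left ≫ m) := by
    rw [← hp.w]
    exact strongEpi_comp _ _
  exact isRegularEpi_of_comp (cyclesToHorn T n i.castSucc).left m

end TorsorsOverBase

end HigherTorsor

end

open HigherTorsor
theorem mainTheorem8 {C : Type u} [Category.{v} C] [HasZeroMorphisms C] [SemiAbelian C]
    {Z : C} (M : BeckModule Z) (n : ℕ) (T : AugSimplicial (Over Z))
    (t : T ⟶ M.eilenbergMacLane (n + 1)) (hT : M.IsTorsor (n + 1) T t) :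
    HasKernelObject M.object (boundary T n).left ∧
    List.TFAE [
      M.IsTrivial,
      IsCentralExtension (boundary T n).left,
      ∀ i : Fin (n + 1),
        IsProductProjectionWithKernel M.object (cyclesToHorn T n i.castSucc).left] := by
  have hp := fun i : Fin (n + 1) => hT.isPullback_cyclesToHorn i.castSucc
  have hreg := hT.isRegularEpi_boundary n
  obtain ⟨m, hm, hq⟩ := hT.exists_isPullback 0
  refine ⟨hasKernelObject_of_isPullback (hp 0) hq, ?_⟩
  tfae_have 1 → 3 := fun ⟨e, he, _, _⟩ i =>
    IsProductProjectionWithKernel.of_isPullback (hp i).flip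
      (IsProductProjectionWithKernel.of_iso_prod e he)
  tfae_have 3 → 2 := fun h =>
    IsProductProjectionWithKernel.isCentralExtension M.isAbelianObject_object hq (h 0)
  tfae_have 2 → 1 := fun h => by
    have := hT.isRegularEpi_horn_hom (0 : Fin (n + 1)).castSucc
    exact exists_iso_prod_of_huqCommute M.proj M.unit M.unit_proj
      (huqCommute_of_isCentralExtension (hp 0) hq M.unit M.unit_proj h)
  tfae_finish
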